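/- Let $K/k$ be a finite Galois extension of fields with group $G=\mathrm{Gal}(K/k)$, let $n\ge 0$, and let $\varphi:G\to \mathrm{GL}(n,\mathbb Z)$ be an injective homomorphism. Let ${}_\varphi\mathcal T(K)=(K^\times)^n$ with the $G$-action $$g\cdot(t_1,\dots,t_n)=\Big(\prod_{i} g(t_i)^{a_{1i}},\dots,\prod_{i} g(t_i)^{a_{ni}}\Big),\qquad \varphi(g)=(a_{ij}).$$ Suppose that $G$ is generated by two elements $g_1=r$, $g_2=s$, and that either $G$ is abelian, or $G$ is a dihedral group in which $r$ is a rotation and $s$ is a reflection. Let $\mathcal U=\mathbb Z$ with an action of $G$ by group automorphisms, let $\varepsilon_i=g_i\cdot 1\in\{1,-1\}$, and let $I=\{g\in G : g\cdot 1=1 \text{ in } \mathcal U\}$. Let $N\le G$ be a subgroup of index $n+1$ with $G/N=\{r^iN : i=0,\dots,n\}$ (left cosets). For $g\in G$ let $T_g$ be the operator $x\otimes y\mapsto gx\otimes y$ on $\mathrm{Ind}_N^G(\mathcal U)=\mathbb Z G\otimes_{\mathbb Z N}\mathcal U$. Suppose that there are integers $b_{ji}$ ($1\le j\le n$, $i=1,2$)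 and a single $\mathbb Z$-basis of $\mathrm{Ind}_N^G(\mathcal U)$ with respect to which, for $i=1,2$, the matrix of $T_{g_i}$ is $$u_i=\begin{pmatrix}\varepsilon_i&0&\cdots&0\\ b_{1i}&&&\\ \vdots&&\varphi(g_i)&\\ b_{ni}&&&\end{pmatrix}.$$ Let $M$ be the subgroup of $H^1(G,{}_\varphi\mathcal T(K))$ generated by the classes of the $1$-cocycles $c(a)$, where $a\in K^\times$ satisfies $g_i(a)=a^{\varepsilon_i}$ for $i=1,2$, and $c(a)$ is the $1$-cocycle with $c(a)_{g_i}=(a^{b_{1i}\varepsilon_i},\dots,a^{b_{ni}\varepsilon_i})$ for $i=1,2$. For a field extension $L/F$, let $\mathrm{Br}(F|L)$ be the group of Brauer classes of central simple $F$-algebras that split over $L$. If $L/F$ is Galois of degree $d\le 2$ and $a\in F^\times$, let $\overline a\in\mathrm{Br}(F|L)$ be the class of the cyclic algebra $(L/F,\sigma,a)$, where $\sigma$ generates $\mathrm{Gal}(L/F)$, i.e. of the central simple $F$-algebra of dimension $d^2$ containing $L$ and an element $w$ with $wy=\sigma(y)w$ for $y\in L$ and $w^d=a$. Then there is a unique group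 homomorphism $\eta:\mathrm{Br}(K^N|K^{I\cap N})\to\mathrm{Br}(k|K^I)$ induced by the norm, that is, with $\eta(\overline a)=\overline{N_{K^N/k}(a)}$ for all $a\in (K^N)^\times$, and $$H^1(G,{}_\varphi\mathcal T(K))/M\;\cong\;\ker\eta$$ as groups. -/

import Mathlib

open scoped TensorProduct

/-! ### First cohomology with coefficients in a multiplicative abelian group -/

namespace ToricGalois

section Cohomology

open groupCohomology

/-- The group of `1`-cocycles `c : G → A`, that is, `c (g * h) = g • c h * c g`. -/
def Z1 (G A : Type*) [Group G] [CommGroup A] [MulDistribMulAction G A] : Subgroup (G → A) where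
  carrier := {c | IsMulCocycle₁ c}
  one_mem' := fun g h => by simp
  mul_mem' := fun {a b} ha hb g h => by
    simp only [Pi.mul_apply, ha g h, hb g h, smul_mul']
    exact mul_mul_mul_comm _ _ _ _
  inv_mem' := fun {a} ha g h => by
    simp only [Pi.inv_apply, ha g h, smul_inv', mul_inv]

/-- The subgroup of `1`-coboundaries `g ↦ g • x / x` in the group of `1`-cocycles. -/
def B1 (G A : Type*) [Group G] [CommGroup A] [MulDistribMulAction G A] : Subgroup (Z1 G A) where
  carrier := {c | IsMulCoboundary₁ (c : G → A)}
  one_mem' := ⟨1, fun g => by simp⟩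
  mul_mem' := by
    rintro a b ⟨x, hx⟩ ⟨y, hy⟩
    refine ⟨x * y, fun g => ?_⟩
    rw [smul_mul', mul_div_mul_comm, hx g, hy g]
    rfl
  inv_mem' := by
    rintro a ⟨x, hx⟩
    refine ⟨x⁻¹, fun g => ?_⟩
    have h : g • x⁻¹ / x⁻¹ = (g • x / x)⁻¹ := by
      rw [smul_inv', inv_div_inv, inv_div]
    rw [h, hx g]
    rfl

/-- `H¹(G, A)`, written multiplicatively: cocycles modulo coboundaries. -/
abbrev H1 (G A : Type*) [Group G] [CommGroup A] [MulDistribMulAction G A] : Type _ :=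
  Z1 G A ⧸ B1 G A

end Cohomology

/-! ### The torus attached to an integral representation of the Galois group -/

section Torus

variable {k K : Type*} [Field k] [Field K] [Algebra k K]

/-- The `K`-points of the torus attached to `φ : Gal(K/k) → GL(n, ℤ)`: as a group this is
`(Kˣ)ⁿ`; the Galois action is the one twisted by `φ`, see the instance below. -/
def TorusPoints {n : ℕ} (_φ : Gal(K/k) →* GL (Fin n) ℤ) : Type _ := Fin n → Kˣ

variable {n : ℕ} (φ : Gal(K/k) →* GL (Fin n) ℤ)

instance : CommGroup (TorusPoints φ) := inferInstanceAs (CommGroup (Fin n → Kˣ))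

/-- `g • (t₁, …, tₙ) = (∏ i, g(t_i) ^ a_{1 i}, …, ∏ i, g(t_i) ^ a_{n i})` where
`φ g = (a_{i j})`. -/
instance : MulDistribMulAction Gal(K/k) (TorusPoints φ) where
  smul g t := fun j => ∏ i, (g • t i) ^ ((φ g : Matrix (Fin n) (Fin n) ℤ) j i)
  one_smul t := by
    funext j
    change ∏ i, ((1 : Gal(K/k)) • t i) ^ ((φ 1 : Matrix (Fin n) (Fin n) ℤ) j i) = t j
    rw [Finset.prod_eq_single j]
    · simp
    · intro i _ hij
      simp [Matrix.one_apply_ne' hij]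
    · simp
  mul_smul g h t := by
    funext j
    change ∏ i, ((g * h) • t i) ^ ((φ (g * h) : Matrix (Fin n) (Fin n) ℤ) j i) =
      ∏ l, (g • ∏ i, (h • t i) ^ ((φ h : Matrix (Fin n) (Fin n) ℤ) l i)) ^
        ((φ g : Matrix (Fin n) (Fin n) ℤ) j l)
    simp only [map_mul, Units.val_mul, Matrix.mul_apply, Finset.smul_prod', smul_zpow',
      ← Finset.prod_zpow, ← zpow_mul, mul_smul]
    rw [Finset.prod_comm]
    refine Finset.prod_congr rfl fun i _ => ?_
    have hz : ∀ (x : Kˣ) (f : Fin n → ℤ), x ^ ∑ l, f l = ∏ l, x ^ f l := fun x f =>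
      congrArg Additive.toMul (Finset.sum_smul (s := Finset.univ) (f := f)
        (x := Additive.ofMul x))
    rw [hz]
    exact Finset.prod_congr rfl fun l _ => by rw [mul_comm]
  smul_one g := by
    funext j
    change ∏ i, (g • (1 : Kˣ)) ^ ((φ g : Matrix (Fin n) (Fin n) ℤ) j i) = 1
    simp
  smul_mul g s t := by
    funext j
    change ∏ i, (g • (s i * t i)) ^ ((φ g : Matrix (Fin n) (Fin n) ℤ) j i) =
      (∏ i, (g • s i) ^ ((φ g : Matrix (Fin n) (Fin n) ℤ) j i)) *
        ∏ i, (g • t i) ^ ((φ g : Matrix (Fin n) (Fin n) ℤ) j i)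
    simp [smul_mul', mul_zpow, Finset.prod_mul_distrib]

end Torus

/-! ### `G`-integers, induced modules and the similarity condition -/

section GInteger

variable {G : Type*} [Group G]

/-- The canonical subgroup of a `G`-integer (an action of `G` on the group `ℤ`). -/
def canonicalSubgroup (U : Representation ℤ G ℤ) : Subgroup G where
  carrier := {g | U g 1 = 1}
  one_mem' := by simp
  mul_mem' := fun {a b} ha hb => by
    simp only [Set.mem_ofPred_eq] at *
    rw [map_mul, Module.End.mul_apply, hb, ha]
  inv_mem' := fun {a} ha => by
    simp only [Set.mem_ofPred_eq] at *
    conv_lhs => rw [← ha]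
    rw [← Module.End.mul_apply, ← map_mul]
    simp

/-- The representation `Ind_N^G U` of `G`; the operator attached to `g : G` is the left
multiplication `x ⊗ y ↦ g x ⊗ y`. -/
noncomputable abbrev indGInteger (U : Representation ℤ G ℤ) (N : Subgroup G) :
    Representation ℤ G (Representation.IndV N.subtype (U.comp N.subtype)) :=
  Representation.ind N.subtype (U.comp N.subtype)

/-- A family of operators on a `ℤ`-module is simultaneously similar to a family of integral
square matrices if the matrices of the operators with respect to some `ℤ`-basis are the given
ones. -/
def SimultaneouslySimilar {ι m V : Type*} [Fintype m] [DecidableEq m] [AddCommGroup V]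
    (T : ι → Module.End ℤ V) (A : ι → Matrix m m ℤ) : Prop :=
  ∃ v : Module.Basis m ℤ V, ∀ i, LinearMap.toMatrix v v (T i) = A i

/-- The square matrix of size `1 + n` with first row `(ε, 0, …, 0)`, first column
`(ε, b₁, …, bₙ)` and lower right block `A`. -/
def borderedMatrix {n : ℕ} (ε : ℤ) (b : Fin n → ℤ) (A : Matrix (Fin n) (Fin n) ℤ) :
    Matrix (Unit ⊕ Fin n) (Unit ⊕ Fin n) ℤ :=
  Matrix.fromBlocks (Matrix.of fun _ _ => ε) 0 (Matrix.of fun j _ => b j) A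

end GInteger

/-- For generators `g i` of `Gal(K/k)`, a `G`-integer `U` with `g i • 1 = ε i` and integers
`b i j`, the subgroup of `H¹(Gal(K/k), T(K))` generated by the classes of the `1`-cocycles `c(a)`,
where `a ∈ Kˣ` satisfies `g i (a) = a ^ ε i` for all `i` and
`c(a) (g i) = (a ^ (b i 1 * ε i), …, a ^ (b i n * ε i))` for all `i`. -/
def explicitSubgroup {k K : Type*} [Field k] [Field K] [Algebra k K] {n : ℕ} {ι : Type*}
    (φ : Gal(K/k) →* GL (Fin n) ℤ) (g : ι → Gal(K/k)) (U : Representation ℤ Gal(K/k) ℤ)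
    (b : ι → Fin n → ℤ) : Subgroup (H1 Gal(K/k) (TorusPoints φ)) :=
  Subgroup.closure {x | ∃ (a : Kˣ) (c : Z1 Gal(K/k) (TorusPoints φ)),
    (∀ i, g i • a = a ^ (U (g i) 1)) ∧
    (∀ i, (c : Gal(K/k) → TorusPoints φ) (g i) = fun j => a ^ (b i j * U (g i) 1)) ∧
    x = QuotientGroup.mk c}

/-! ### The Brauer group and the relative Brauer group -/

section TensorCSA

variable {F A B : Type*} [Field F] [Ring A] [Algebra F A] [Ring B] [Algebra F B]

theorem basis_repr_mul_right {ι : Type*} (b : Module.Basis ι F B) (x : A ⊗[F] B) (a : A)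
    (i : ι) : (Algebra.TensorProduct.basis A b).repr (x * (a ⊗ₜ[F] 1)) i =
      (Algebra.TensorProduct.basis A b).repr x i * a := by
  induction x using TensorProduct.induction_on with
  | zero => simp
  | tmul p q =>
    simp [Algebra.TensorProduct.basis_repr_tmul, mul_assoc, Algebra.commutes]
  | add x y hx hy => simp [add_mul, hx, hy]

theorem basis_repr_mul_left {ι : Type*} (b : Module.Basis ι F B) (x : A ⊗[F] B) (a : A)
    (i : ι) : (Algebra.TensorProduct.basis A b).repr ((a ⊗ₜ[F] 1) * x) i =
      a * (Algebra.TensorProduct.basis A b).repr x i := by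
  induction x using TensorProduct.induction_on with
  | zero => simp
  | tmul p q =>
    simp [Algebra.TensorProduct.basis_repr_tmul, mul_assoc]
  | add x y hx hy => simp [mul_add, hx, hy]

theorem exists_eq_one_tmul [Algebra.IsCentral F A] (x : A ⊗[F] B)
    (hx : ∀ a : A, (a ⊗ₜ[F] (1 : B)) * x = x * (a ⊗ₜ[F] 1)) : ∃ y : B, x = 1 ⊗ₜ[F] y := by
  let b := Module.Basis.ofVectorSpace F B
  let c := Algebra.TensorProduct.basis A b
  have hc : ∀ i, ∃ f : F, algebraMap F A f = c.repr x i := fun i => by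
    have : c.repr x i ∈ Subalgebra.center F A := by
      rw [Subalgebra.mem_center_iff]
      intro a
      have := congrArg (fun z => c.repr z i) (hx a)
      simpa only [c, basis_repr_mul_left, basis_repr_mul_right] using this
    rw [Algebra.IsCentral.center_eq_bot] at this
    exact Algebra.mem_bot.1 this
  choose f hf using hc
  refine ⟨(c.repr x).support.sum fun i => f i • b i, ?_⟩
  conv_lhs => rw [← c.linearCombination_repr x, Finsupp.linearCombination_apply, Finsupp.sum]
  rw [TensorProduct.tmul_sum]
  refine Finset.sum_congr rfl fun i _ => ?_
  rw [← hf i, Algebra.TensorProduct.basis_apply, TensorProduct.smul_tmul', smul_eq_mul, mul_one,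
    Algebra.algebraMap_eq_smul_one, TensorProduct.smul_tmul]

/-- The tensor product of central algebras over a field is central. -/
theorem isCentral_tensor [Nontrivial A] [Algebra.IsCentral F A] [Algebra.IsCentral F B] :
    Algebra.IsCentral F (A ⊗[F] B) where
  out x hx := by
    rw [Subalgebra.mem_center_iff] at hx
    obtain ⟨y, rfl⟩ := exists_eq_one_tmul x fun a => hx _
    have hy : y ∈ Subalgebra.center F B := by
      rw [Subalgebra.mem_center_iff]
      intro z
      have := hx (1 ⊗ₜ z)
      simp only [Algebra.TensorProduct.tmul_mul_tmul, mul_one] at this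
      exact Algebra.TensorProduct.includeRight_injective (R := F) (A := A) (B := B)
        (FaithfulSMul.algebraMap_injective F A) this
    rw [Algebra.IsCentral.center_eq_bot] at hy
    obtain ⟨f, rfl⟩ := Algebra.mem_bot.1 hy
    exact Algebra.mem_bot.2 ⟨f, by
      rw [Algebra.TensorProduct.algebraMap_apply, Algebra.algebraMap_eq_smul_one,
        Algebra.algebraMap_eq_smul_one, TensorProduct.smul_tmul]⟩

/-- The tensor product of a central simple algebra and a simple algebra over a field is simple. -/
theorem isSimpleRing_tensor [IsSimpleRing A] [IsSimpleRing B] [Algebra.IsCentral F A] :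
    IsSimpleRing (A ⊗[F] B) := by
  classical
  let b := Module.Basis.ofVectorSpace F B
  let c := Algebra.TensorProduct.basis A b
  refine ⟨⟨fun I => ?_⟩⟩
  by_cases hI : ∃ x ∈ I, x ≠ 0
  swap
  · left
    push Not at hI
    exact le_antisymm (fun x hx => (TwoSidedIdeal.mem_bot _).2 (hI x hx)) bot_le
  right
  have hex : ∃ m, ∃ x ∈ I, x ≠ 0 ∧ (c.repr x).support.card = m := by
    obtain ⟨x, hx, hx0⟩ := hI
    exact ⟨_, x, hx, hx0, rfl⟩
  obtain ⟨x, hxI, hx0, hxm⟩ := Nat.find_spec hex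
  have hmin : ∀ z ∈ I, (c.repr z).support.card < (c.repr x).support.card → z = 0 := by
    intro z hz hlt
    by_contra hz0
    exact Nat.find_min hex (hxm ▸ hlt) ⟨z, hz, hz0, rfl⟩
  obtain ⟨i₀, hi₀⟩ : (c.repr x).support.Nonempty := by
    rw [Finsupp.support_nonempty_iff]
    exact fun h => hx0 (c.repr.map_eq_zero_iff.1 h)
  let J : TwoSidedIdeal A := TwoSidedIdeal.mk'
    {a | ∃ y ∈ I, c.repr y i₀ = a ∧ (c.repr y).support ⊆ (c.repr x).support}
    ⟨0, I.zero_mem, by simp, by simp⟩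
    (by
      rintro _ _ ⟨y, hy, rfl, hys⟩ ⟨z, hz, rfl, hzs⟩
      refine ⟨y + z, I.add_mem hy hz, by simp, ?_⟩
      rw [map_add]
      exact Finsupp.support_add.trans (Finset.union_subset hys hzs))
    (by
      rintro _ ⟨y, hy, rfl, hys⟩
      exact ⟨-y, I.neg_mem hy, by simp, by rwa [map_neg, Finsupp.support_neg]⟩)
    (by
      rintro a _ ⟨y, hy, rfl, hys⟩
      refine ⟨(a ⊗ₜ 1) * y, I.mul_mem_left _ _ hy, basis_repr_mul_left b y a i₀, fun i hi => ?_⟩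
      refine hys (Finsupp.mem_support_iff.2 fun h => Finsupp.mem_support_iff.1 hi ?_)
      rw [basis_repr_mul_left, h, mul_zero])
    (by
      rintro _ a ⟨y, hy, rfl, hys⟩
      refine ⟨y * (a ⊗ₜ 1), I.mul_mem_right _ _ hy, basis_repr_mul_right b y a i₀, fun i hi => ?_⟩
      refine hys (Finsupp.mem_support_iff.2 fun h => Finsupp.mem_support_iff.1 hi ?_)
      rw [basis_repr_mul_right, h, zero_mul])
  have hJ : (1 : A) ∈ J := IsSimpleRing.one_mem_of_ne_zero_mem J
    (Finsupp.mem_support_iff.1 hi₀) ((TwoSidedIdeal.mem_mk' _ _ _ _ _ _ _).2 ⟨x, hxI, rfl, subset_rfl⟩)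
  obtain ⟨y, hyI, hy1, hys⟩ := (TwoSidedIdeal.mem_mk' _ _ _ _ _ _ _).1 hJ
  have hcomm : ∀ a : A, (a ⊗ₜ[F] (1 : B)) * y = y * (a ⊗ₜ[F] 1) := by
    intro a
    rw [← sub_eq_zero]
    refine hmin _ (I.sub_mem (I.mul_mem_left _ _ hyI) (I.mul_mem_right _ _ hyI)) ?_
    refine Finset.card_lt_card (Finset.ssubset_iff_subset_ne.2 ⟨fun i hi => ?_, fun h => ?_⟩)
    · refine hys (Finsupp.mem_support_iff.2 fun h => Finsupp.mem_support_iff.1 hi ?_)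
      rw [map_sub, Finsupp.sub_apply, basis_repr_mul_left, basis_repr_mul_right, h, mul_zero,
        zero_mul, sub_zero]
    · rw [← h] at hi₀
      refine Finsupp.mem_support_iff.1 hi₀ ?_
      rw [map_sub, Finsupp.sub_apply, basis_repr_mul_left, basis_repr_mul_right, hy1, mul_one,
        one_mul, sub_self]
  obtain ⟨z, rfl⟩ := exists_eq_one_tmul y hcomm
  have hz0 : z ≠ 0 := by
    rintro rfl
    simp at hy1
  have h1 : (1 : B) ∈ I.comap (Algebra.TensorProduct.includeRight : B →ₐ[F] A ⊗[F] B) :=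
    IsSimpleRing.one_mem_of_ne_zero_mem _ hz0 (TwoSidedIdeal.mem_comap _ |>.2 hyI)
  rw [TwoSidedIdeal.mem_comap, map_one] at h1
  exact (TwoSidedIdeal.one_mem_iff I).1 h1

/-- `A ⊗ Aᵐᵒᵖ` is a matrix algebra for a finite dimensional central simple algebra `A`. -/
theorem tensor_op_equiv_matrix (A : Type*) [Ring A] [Algebra F A] [IsSimpleRing A]
    [Algebra.IsCentral F A] [FiniteDimensional F A] :
    ∃ n : ℕ, n ≠ 0 ∧ Nonempty (A ⊗[F] Aᵐᵒᵖ ≃ₐ[F] Matrix (Fin n) (Fin n) F) := by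
  have := isSimpleRing_tensor (F := F) (A := A) (B := Aᵐᵒᵖ)
  have hinj : Function.Injective (AlgHom.mulLeftRight F A) :=
    (AlgHom.mulLeftRight F A).toRingHom.injective
  have hfr : Module.finrank F (A ⊗[F] Aᵐᵒᵖ) = Module.finrank F (Module.End F A) := by
    rw [Module.finrank_tensorProduct, Module.finrank_linearMap,
      (MulOpposite.opLinearEquiv F (M := A)).finrank_eq]
  have hbij : Function.Bijective (AlgHom.mulLeftRight F A) :=
    ⟨hinj, (LinearMap.injective_iff_surjective_of_finrank_eq_finrank
      (f := (AlgHom.mulLeftRight F A).toLinearMap) hfr).1 hinj⟩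
  exact ⟨Module.finrank F A, Module.finrank_pos.ne',
    ⟨(AlgEquiv.ofBijective _ hbij).trans (algEquivMatrix (Module.finBasis F A))⟩⟩

end TensorCSA

section Brauer

universe u v

variable {F : Type u} [Field F]

/-- The bundled central simple algebra attached to an unbundled one. -/
abbrev csaOf (F : Type u) [Field F] (A : Type v) [Ring A] [Algebra F A] [IsSimpleRing A]
    [Algebra.IsCentral F A] [FiniteDimensional F A] : CSA.{u, v} F :=
  { AlgCat.of F A with
    isCentral := ‹Algebra.IsCentral F A›
    isSimple := ‹IsSimpleRing A›
    fin_dim := ‹FiniteDimensional F A› }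

/-- The tensor product of two central simple algebras. -/
noncomputable def tensorCSA (A B : CSA.{u, u} F) : CSA.{u, u} F :=
  haveI := isCentral_tensor (F := F) (A := A) (B := B)
  haveI := isSimpleRing_tensor (F := F) (A := A) (B := B)
  csaOf F (A ⊗[F] B)

theorem brauerEquivalent_of_algEquiv {A B : CSA.{u, u} F} (e : A ≃ₐ[F] B) :
    IsBrauerEquivalent A B :=
  ⟨1, 1, one_ne_zero, one_ne_zero, ⟨e.mapMatrix⟩⟩

theorem tensorCSA_congr {A A' B B' : CSA.{u, u} F} (hA : IsBrauerEquivalent A A')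
    (hB : IsBrauerEquivalent B B') :
    IsBrauerEquivalent (tensorCSA A B) (tensorCSA A' B') := by
  obtain ⟨n, m, hn, hm, ⟨e⟩⟩ := hA
  obtain ⟨p, q, hp, hq, ⟨f⟩⟩ := hB
  refine ⟨n * p, m * q, mul_ne_zero hn hp, mul_ne_zero hm hq, ⟨?_⟩⟩
  exact (Matrix.reindexAlgEquiv F (A ⊗[F] B) finProdFinEquiv).symm.trans <|
    (Matrix.kroneckerTMulAlgEquiv (Fin n) (Fin p) F F A B).symm.trans <|
    (Algebra.TensorProduct.congr e f).trans <|
    (Matrix.kroneckerTMulAlgEquiv (Fin m) (Fin q) F F A' B').trans <|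
    Matrix.reindexAlgEquiv F (A' ⊗[F] B') finProdFinEquiv

/-- The opposite of a central simple algebra. -/
def opCSA (A : CSA.{u, u} F) : CSA.{u, u} F := csaOf F Aᵐᵒᵖ

/-- The opposite of a matrix algebra is the matrix algebra over the opposite algebra. -/
def matrixOpEquiv (F : Type*) [Field F] (A : Type*) [Ring A] [Algebra F A] (n : ℕ) :
    Matrix (Fin n) (Fin n) Aᵐᵒᵖ ≃ₐ[F] (Matrix (Fin n) (Fin n) A)ᵐᵒᵖ :=
  AlgEquiv.ofLinearEquiv
    { toFun := fun M => MulOpposite.op (Matrix.of fun i j => (M j i).unop)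
      invFun := fun M => Matrix.of fun i j => MulOpposite.op (M.unop j i)
      left_inv := fun _ => rfl
      right_inv := fun _ => rfl
      map_add' := fun _ _ => rfl
      map_smul' := fun _ _ => rfl }
    (congrArg MulOpposite.op (Matrix.ext fun i j => by
      change ((1 : Matrix (Fin n) (Fin n) Aᵐᵒᵖ) j i).unop = (1 : Matrix (Fin n) (Fin n) A) i j
      by_cases h : i = j
      · subst h; simp
      · simp [Matrix.one_apply_ne h, Matrix.one_apply_ne' h]))
    (fun x y => congrArg MulOpposite.op (Matrix.ext fun i j => by
      change ((x * y) j i).unop = ∑ l, (y l i).unop * (x j l).unop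
      simp [Matrix.mul_apply]))

/-- Matrices of size one. -/
def matrixOneEquiv (F : Type*) [Field F] (A : Type*) [Ring A] [Algebra F A] :
    Matrix (Fin 1) (Fin 1) A ≃ₐ[F] A :=
  AlgEquiv.ofLinearEquiv
    { toFun := fun M => M 0 0
      invFun := fun a => Matrix.of fun _ _ => a
      left_inv := fun M => Matrix.ext fun i j => by
        rw [Subsingleton.elim i 0, Subsingleton.elim j 0]; rfl
      right_inv := fun _ => rfl
      map_add' := fun _ _ => rfl
      map_smul' := fun _ _ => rfl }
    rfl
    (fun x y => by
      change (x * y) 0 0 = x 0 0 * y 0 0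
      simp [Matrix.mul_apply])

theorem opCSA_congr {A B : CSA.{u, u} F} (h : IsBrauerEquivalent A B) :
    IsBrauerEquivalent (opCSA A) (opCSA B) := by
  obtain ⟨n, m, hn, hm, ⟨e⟩⟩ := h
  exact ⟨n, m, hn, hm, ⟨(matrixOpEquiv F A n).trans <| e.op.trans (matrixOpEquiv F B m).symm⟩⟩

/-- The Brauer group: the product of the classes of `A` and `B` is the class of `A ⊗ B`, the unit
is the class of `F` and the inverse of the class of `A` is the class of the opposite algebra. -/
noncomputable instance : CommGroup (BrauerGroup.{u, u} F) where
  mul := Quotient.map₂ tensorCSA fun _ _ hA _ _ hB => tensorCSA_congr hA hB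
  one := Quotient.mk _ (csaOf F F)
  inv := Quotient.map opCSA fun _ _ h => opCSA_congr h
  mul_assoc x y z := by
    induction x, y, z using Quotient.inductionOn₃ with
    | h A B C => exact Quotient.sound (brauerEquivalent_of_algEquiv
        (Algebra.TensorProduct.assoc F F F A B C))
  one_mul x := by
    induction x using Quotient.inductionOn with
    | h A => exact Quotient.sound (brauerEquivalent_of_algEquiv (Algebra.TensorProduct.lid F A))
  mul_one x := by
    induction x using Quotient.inductionOn with
    | h A => exact Quotient.sound (brauerEquivalent_of_algEquiv (Algebra.TensorProduct.rid F F A))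
  inv_mul_cancel x := by
    induction x using Quotient.inductionOn with
    | h A =>
      obtain ⟨n, hn, ⟨e⟩⟩ := tensor_op_equiv_matrix (F := F) A
      refine Quotient.sound ⟨1, n, one_ne_zero, hn, ⟨?_⟩⟩
      exact (matrixOneEquiv F (Aᵐᵒᵖ ⊗[F] A)).trans <|
        (Algebra.TensorProduct.comm F Aᵐᵒᵖ A).trans e
  mul_comm x y := by
    induction x, y using Quotient.inductionOn₂ with
    | h A B => exact Quotient.sound (brauerEquivalent_of_algEquiv
        (Algebra.TensorProduct.comm F A B))

/-- A central simple `F`-algebra splits over `L` if its base change to `L` is a matrix algebra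
over `L`. -/
def IsSplitOver (L : Type v) [Field L] [Algebra F L] (A : CSA.{u, u} F) : Prop :=
  ∃ n : ℕ, n ≠ 0 ∧ Nonempty (L ⊗[F] A ≃ₐ[L] Matrix (Fin n) (Fin n) L)

/-- The relative Brauer group `Br(F|L)`: the classes of the central simple `F`-algebras which
split over `L`. -/
noncomputable def relBrauerGroup (F : Type u) [Field F] (L : Type v) [Field L] [Algebra F L] :
    Subgroup (BrauerGroup.{u, u} F) where
  carrier := {x | ∃ A : CSA.{u, u} F, IsSplitOver L A ∧ x = Quotient.mk _ A}
  one_mem' := ⟨csaOf F F, ⟨1, one_ne_zero, ⟨(Algebra.TensorProduct.rid F L L).trans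
    (matrixOneEquiv L L).symm⟩⟩, rfl⟩
  mul_mem' := by
    rintro _ _ ⟨A, ⟨n, hn, ⟨e⟩⟩, rfl⟩ ⟨B, ⟨m, hm, ⟨f⟩⟩, rfl⟩
    refine ⟨tensorCSA A B, ⟨n * m, mul_ne_zero hn hm, ⟨?_⟩⟩, rfl⟩
    exact (Algebra.TensorProduct.congr (Algebra.TensorProduct.lid L L).symm
        (AlgEquiv.refl (R := F) (A₁ := A ⊗[F] B))).trans <|
      (Algebra.TensorProduct.tensorTensorTensorComm F F L L L A L B).symm.trans <|
      (Algebra.TensorProduct.congr e f).trans <|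
      (Matrix.kroneckerAlgEquiv (Fin n) (Fin m) L).trans <|
      Matrix.reindexAlgEquiv L L finProdFinEquiv
  inv_mem' := by
    rintro _ ⟨A, ⟨n, hn, ⟨e⟩⟩, rfl⟩
    refine ⟨opCSA A, ⟨n, hn, ⟨?_⟩⟩, rfl⟩
    exact (Algebra.TensorProduct.congr (AlgEquiv.toOpposite L L) AlgEquiv.refl).trans <|
      (Algebra.TensorProduct.opAlgEquiv F L L A).trans <|
      e.op.trans (Matrix.transposeAlgEquiv (Fin n) L L).symm

/-- For a cyclic extension `L/F` of degree `d`, the element `x` of `Br(F|L)` is the class `ā` of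
`a ∈ Fˣ` under the identification `Br(F|L) = Fˣ / N(Lˣ)`, that is, `x` is the class of the cyclic
algebra `(L/F, σ, a)`: a central simple `F`-algebra of dimension `d²` which contains `L` and an
element `w` such that `w y = σ(y) w` for `y ∈ L` and `w ^ d = a`, where `σ` generates `Gal(L/F)`.
(It is used for `d ≤ 2` only, where `σ` is unique.) -/
def IsCyclicClass {L : Type v} [Field L] [Algebra F L] (a : Fˣ) (x : relBrauerGroup F L) : Prop :=
  ∃ (σ : Gal(L/F)) (A : CSA.{u, u} F) (j : L →ₐ[F] A) (w : A),
    (∀ τ : Gal(L/F), τ ∈ Subgroup.zpowers σ) ∧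
    Module.finrank F A = Module.finrank F L ^ 2 ∧
    (∀ y : L, w * j y = j (σ y) * w) ∧
    w ^ Module.finrank F L = algebraMap F A a ∧
    (x : BrauerGroup.{u, u} F) = Quotient.mk _ A

/-- For fields `k ⊆ F`, a homomorphism `η : Br(F|L) → Br(k|E)` is induced by the norm
`N : F → k` if it sends the class of `a` to the class of `N(a)` for all `a ∈ Fˣ`. -/
def IsInducedByNorm {k : Type v} [Field k] [Algebra k F] {L E : Type*} [Field L] [Algebra F L]
    [Field E] [Algebra k E] (η : relBrauerGroup F L →* relBrauerGroup k E) : Prop :=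
  ∀ (a : Fˣ) (x : relBrauerGroup F L), IsCyclicClass a x →
    IsCyclicClass (Units.map (Algebra.norm k : F →* k) a) (η x)

end Brauer

end ToricGalois

/-! The block shape of the matrices `u_i` says that, in the given basis of `Ind_N^G U`, the last `n`
vectors span a `G`-stable sublattice on which `G` acts through `φ`, with quotient `U`. Tensoring `0
→ ℤⁿ → Ind_N^G U → U → 0` with `Kˣ` gives an exact sequence of `G`-modules `1 → T(K) → Coind → U ⊗
Kˣ → 1`. Here `U ⊗ Kˣ` is `Kˣ` with the Galois action twisted by the sign character `χ` of `U`, and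
the middle term is coinduced from `N`. The result is read off from the piece `H⁰(G, U ⊗ Kˣ) → H¹(G,
T(K)) → H¹(G, Coind) → H¹(G, U ⊗ Kˣ)` of the long exact sequence.

The image of the connecting map is `M`. An invariant of `U ⊗ Kˣ` is an `a` with `g(a) = a ^ χ(g)`;
it lifts to `a ⊗ v₀`, where `v₀` is the first basis vector, and the coboundary of that lift takes on
`g_i` the value prescribed for `c(a)`, because `g_i v₀ = ε_i v₀ + ∑ b_{ji} v_j`.

By Shapiro's lemma the third term is `H¹(N, U ⊗ Kˣ)`. Hilbert 90 on `N ∩ ker χ` reduces it to the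
cohomology of a group of order at most two acting on the units of `K^{I ∩ N}`: the units of `K^N`
modulo norms, which is `Br(K^N|K^{I ∩ N})`. In the same way the last term contains `kˣ` modulo norms
from `K^I`, which is `Br(k|K^I)`, and the map between them is the norm from `K^N` to `k`. Hence
`H¹(G, T(K)) / M` is the kernel of `η`.

The Brauer side is `exists_relBrauerGroup_parametrization`, built on explicit quaternion-type
algebras. The lattice side is `nonempty_adaptedMatrices` and `AdaptedMatrices.torusResolution`. The
cohomological argument, carried out on cocycles, is
`TorusResolution.nonempty_quotient_mulEquiv_ker`. -/

namespace ToricGalois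

/-! ### Cyclic algebras of degree two as matrices. -/

section CyclicAlgebra

universe u v w

variable {F : Type u} {L : Type v} [Field F] [Field L] [Algebra F L]

/-- The cyclic algebra `L ⊕ L w` with `w y = σ(y) w` and `w² = a` attached to an involution `σ` of
`L/F`, realized by the matrices `!![p, a q; σ(q), σ(p)]`. -/
def cyclicAlgebra (σ : Gal(L/F)) (hσ : ∀ y, σ (σ y) = y) (a : F) :
    Subalgebra F (Matrix (Fin 2) (Fin 2) L) where
  carrier := {M | M 1 1 = σ (M 0 0) ∧ M 0 1 = algebraMap F L a * σ (M 1 0)}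
  mul_mem' := by
    rintro M M' ⟨h1, h2⟩ ⟨h1', h2'⟩
    simp only [Set.mem_ofPred_eq, Matrix.mul_apply, Fin.sum_univ_two, h1, h2, h1', h2', map_add,
      map_mul, AlgEquiv.commutes, hσ]
    constructor <;> ring
  add_mem' := by
    rintro M M' ⟨h1, h2⟩ ⟨h1', h2'⟩
    simp only [Set.mem_ofPred_eq, Matrix.add_apply, h1, h2, h1', h2', map_add, mul_add, and_self]
  algebraMap_mem' c := by simp [Matrix.algebraMap_matrix_apply]

/-- Matrices attached to the elements `p + q w` of the cyclic algebra. -/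
def cyclicAlgebra.mk (σ : Gal(L/F)) (hσ : ∀ y, σ (σ y) = y) (a : F) (p q : L) :
    cyclicAlgebra σ hσ a :=
  ⟨!![p, algebraMap F L a * q; σ q, σ p], by simp [cyclicAlgebra, hσ]⟩

variable {σ : Gal(L/F)} {hσ : ∀ y, σ (σ y) = y} {a : F}

namespace cyclicAlgebra

theorem exists_eq_mk (x : cyclicAlgebra σ hσ a) : ∃ p q, x = mk σ hσ a p q := by
  obtain ⟨M, h1, h2⟩ := x
  -- The lower left entry of `p + q w` is `σ q`, so `q` is recovered by applying the involution
  -- again.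
  refine ⟨M 0 0, σ (M 1 0), Subtype.ext ?_⟩
  ext i j
  fin_cases i <;> fin_cases j <;> simp [mk, h1, h2, hσ]

theorem mk_inj {p q p' q' : L} : mk σ hσ a p q = mk σ hσ a p' q' ↔ p = p' ∧ q = q' := by
  refine ⟨fun h => ?_, fun h => by rw [h.1, h.2]⟩
  have h' := congrArg Subtype.val h
  exact ⟨congrFun (congrFun h' 0) 0, σ.injective (congrFun (congrFun h' 1) 0)⟩

theorem mk_add (p q p' q' : L) :
    mk σ hσ a p q + mk σ hσ a p' q' = mk σ hσ a (p + p') (q + q') := by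
  refine Subtype.ext ?_
  ext i j
  fin_cases i <;> fin_cases j <;> simp [mk, mul_add]

theorem mk_mul (p q p' q' : L) : mk σ hσ a p q * mk σ hσ a p' q' =
    mk σ hσ a (p * p' + algebraMap F L a * (q * σ q')) (p * q' + q * σ p') := by
  refine Subtype.ext ?_
  ext i j
  fin_cases i <;> fin_cases j <;> simp [mk, Matrix.mul_apply, hσ] <;> ring

theorem one_eq : (1 : cyclicAlgebra σ hσ a) = mk σ hσ a 1 0 := by
  refine Subtype.ext ?_
  ext i j
  fin_cases i <;> fin_cases j <;> simp [mk]

theorem zero_eq : (0 : cyclicAlgebra σ hσ a) = mk σ hσ a 0 0 := by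
  refine Subtype.ext ?_
  ext i j
  fin_cases i <;> fin_cases j <;> simp [mk]

theorem algebraMap_eq (c : F) :
    algebraMap F (cyclicAlgebra σ hσ a) c = mk σ hσ a (algebraMap F L c) 0 := by
  refine Subtype.ext ?_
  ext i j
  fin_cases i <;> fin_cases j <;> simp [mk, Matrix.algebraMap_matrix_apply]

theorem smul_mk (c : F) (p q : L) : c • mk σ hσ a p q = mk σ hσ a (c • p) (c • q) := by
  rw [Algebra.smul_def, algebraMap_eq, mk_mul, Algebra.smul_def, Algebra.smul_def]
  simp

variable (σ hσ a) in
/-- The inclusion of the maximal subfield of the cyclic algebra. -/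
def emb : L →ₐ[F] cyclicAlgebra σ hσ a :=
  AlgHom.ofLinearMap
    { toFun := fun y => mk σ hσ a y 0
      map_add' := fun x y => by simp [mk_add]
      map_smul' := fun c y => by simp [smul_mk] }
    one_eq.symm (fun x y => by simp [mk_mul])

variable (σ hσ a) in
theorem emb_apply (y : L) : emb σ hσ a y = mk σ hσ a y 0 := rfl

/-- The cyclic algebra maps to any algebra with an embedding of `L` and an element `w` satisfying
the defining relations. -/
def lift {A : Type w} [Ring A] [Algebra F A] (j : L →ₐ[F] A) (w : A)
    (hw : ∀ y, w * j y = j (σ y) * w) (ha : w * w = algebraMap F A a) :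
    cyclicAlgebra σ hσ a →ₐ[F] A :=
  AlgHom.ofLinearMap
    { toFun := fun x => j (x.1 0 0) + j (σ (x.1 1 0)) * w
      map_add' := fun x y => by simp [add_mul]; abel
      map_smul' := fun c y => by simp }
    (by simp)
    (fun x y => by
      obtain ⟨p, q, rfl⟩ := exists_eq_mk x
      obtain ⟨p', q', rfl⟩ := exists_eq_mk y
      have h1 : j q * w * (j q' * w) = j (algebraMap F L a * (q * σ q')) := by
        rw [mul_assoc, ← mul_assoc w, hw, mul_assoc, ha, map_mul, j.commutes, map_mul,
          Algebra.commutes a (j q * j (σ q')), mul_assoc]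
      have h2 : j q * w * j p' = j (q * σ p') * w := by
        rw [mul_assoc, hw, map_mul, mul_assoc]
      rw [mk_mul]
      simp only [mk, LinearMap.coe_mk, AddHom.coe_mk, Matrix.of_apply, Matrix.cons_val_zero,
        Matrix.cons_val_one, Matrix.cons_val', Matrix.cons_val_fin_one, hσ]
      rw [mul_add, add_mul, add_mul, h1, h2]
      simp only [map_add, map_mul, add_mul]
      simp only [mul_assoc]
      abel)

theorem lift_mk {A : Type w} [Ring A] [Algebra F A] (j : L →ₐ[F] A) (w : A)
    (hw : ∀ y, w * j y = j (σ y) * w) (ha : w * w = algebraMap F A a) (p q : L) :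
    lift (hσ := hσ) j w hw ha (mk σ hσ a p q) = j p + j q * w := by
  change j p + j (σ (σ q)) * w = _
  rw [hσ]

variable (σ hσ a) in
/-- The cyclic algebra is the direct sum of two copies of `L`. -/
noncomputable def equivProd : (L × L) ≃ₗ[F] cyclicAlgebra σ hσ a :=
  LinearEquiv.ofBijective
    { toFun := fun x => mk σ hσ a x.1 x.2
      map_add' := fun x y => by simp [mk_add]
      map_smul' := fun c y => by simp [smul_mk] }
    ⟨fun x y h => Prod.ext (mk_inj.1 h).1 (mk_inj.1 h).2, fun x => by
      obtain ⟨p, q, rfl⟩ := exists_eq_mk x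
      exact ⟨(p, q), rfl⟩⟩

theorem finrank_eq [FiniteDimensional F L] (hL : Module.finrank F L = 2) :
    Module.finrank F (cyclicAlgebra σ hσ a) = 4 := by
  rw [← (equivProd σ hσ a).finrank_eq, Module.finrank_prod, hL]

theorem isUnit_mk_left {p : L} (hp : p ≠ 0) : mk σ hσ a p 0 * mk σ hσ a p⁻¹ 0 = 1 := by
  rw [mk_mul, one_eq, mk_inj]
  simp [hp]

theorem isUnit_mk_right (ha : a ≠ 0) {q : L} (hq : q ≠ 0) :
    mk σ hσ a 0 q * mk σ hσ a 0 (σ ((algebraMap F L a * q)⁻¹)) = 1 := by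
  have ha' : algebraMap F L a ≠ 0 := by simpa using ha
  rw [mk_mul, one_eq, mk_inj, hσ]
  constructor
  · field_simp
    ring
  · simp

variable (hσ) in
-- Commuting with an element `θ` moved by `σ` forces `q = 0`, and commuting with `w` then forces `σ
-- p = p`.
theorem isCentral (hfix : ∀ y, σ y = y → ∃ c, algebraMap F L c = y)
    (hne : ∃ y, σ y ≠ y) : Algebra.IsCentral F (cyclicAlgebra σ hσ a) where
  out x hx := by
    rw [Subalgebra.mem_center_iff] at hx
    obtain ⟨p, q, rfl⟩ := exists_eq_mk x
    obtain ⟨θ, hθ⟩ := hne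
    have h1 := hx (mk σ hσ a θ 0)
    have h2 := hx (mk σ hσ a 0 1)
    simp only [mk_mul, mk_inj] at h1 h2
    have hq : q = 0 := by
      have : q * (σ θ - θ) = 0 := by
        have := h1.2
        simp only [zero_mul, add_zero, mul_zero, zero_add] at this
        rw [mul_sub, ← this]
        ring
      exact (mul_eq_zero.1 this).resolve_right (sub_ne_zero.2 hθ)
    subst hq
    obtain ⟨c, rfl⟩ := hfix p (by simpa using h2.2)
    exact Algebra.mem_bot.2 ⟨c, algebraMap_eq c⟩

variable (hσ) in
theorem isSimple (ha : a ≠ 0) (hne : ∃ y, σ y ≠ y) : IsSimpleRing (cyclicAlgebra σ hσ a) := by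
  obtain ⟨θ, hθ⟩ := hne
  refine ⟨⟨fun I => ?_⟩⟩
  by_cases hI : ∃ x ∈ I, x ≠ 0
  swap
  · left
    push Not at hI
    exact le_antisymm (fun x hx => (TwoSidedIdeal.mem_bot _).2 (hI x hx)) bot_le
  right
  refine (TwoSidedIdeal.one_mem_iff I).1 ?_
  obtain ⟨x, hxI, hx0⟩ := hI
  obtain ⟨p, q, rfl⟩ := exists_eq_mk x
  by_cases hq : q = 0
  · subst hq
    have hp : p ≠ 0 := by
      rintro rfl
      exact hx0 zero_eq.symm
    rw [← isUnit_mk_left hp]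
    exact I.mul_mem_right _ _ hxI
  -- The commutator with `θ` removes the component in `L` and leaves a nonzero multiple of `w`,
  -- which is a unit.
  · have h1 : mk σ hσ a p q * mk σ hσ a θ 0 - mk σ hσ a θ 0 * mk σ hσ a p q =
        mk σ hσ a 0 (q * (σ θ - θ)) := by
      rw [sub_eq_iff_eq_add, mk_mul, mk_mul, mk_add, mk_inj]
      constructor
      · simp [mul_comm]
      · simp; ring
    rw [← isUnit_mk_right ha (mul_ne_zero hq (sub_ne_zero.2 hθ)), ← h1]
    exact I.mul_mem_right _ _ (I.sub_mem (I.mul_mem_right _ _ hxI) (I.mul_mem_left _ _ hxI))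

end cyclicAlgebra

end CyclicAlgebra

end ToricGalois


namespace ToricGalois

/-! ### Quadratic extensions and the Brauer classes of their cyclic algebras. -/

section QuadraticBrauer

universe u v w

/-- An injective algebra homomorphism from a simple algebra is an isomorphism if the dimensions
agree. -/
theorem nonempty_algEquiv_of_finrank_eq {F : Type*} [Field F] {A B : Type*} [Ring A] [Algebra F A]
    [Ring B] [Algebra F B] [IsSimpleRing A] [Nontrivial B] [FiniteDimensional F A]
    [FiniteDimensional F B] (f : A →ₐ[F] B) (h : Module.finrank F A = Module.finrank F B) :
    Nonempty (A ≃ₐ[F] B) := by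
  have hinj : Function.Injective f := f.toRingHom.injective
  exact ⟨AlgEquiv.ofBijective f ⟨hinj, (LinearMap.injective_iff_surjective_of_finrank_eq_finrank
    (f := f.toLinearMap) h).1 hinj⟩⟩

theorem isSimpleRing_of_ringEquiv {A B : Type*} [Ring A] [Ring B] [IsSimpleRing A] (e : A ≃+* B) :
    IsSimpleRing B :=
  ⟨e.symm.mapTwoSidedIdeal.isSimpleOrder⟩

theorem isCentral_of_algEquiv {F : Type*} [Field F] {A : Type v} {B : Type w} [Ring A]
    [Algebra F A] [Ring B] [Algebra F B] [Algebra.IsCentral F A] (e : A ≃ₐ[F] B) :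
    Algebra.IsCentral F B where
  out x hx := by
    rw [Subalgebra.mem_center_iff] at hx
    have h : e.symm x ∈ Subalgebra.center F A := by
      rw [Subalgebra.mem_center_iff]
      intro y
      apply e.injective
      rw [map_mul, map_mul, e.apply_symm_apply, hx]
    rw [Algebra.IsCentral.center_eq_bot] at h
    obtain ⟨c, hc⟩ := Algebra.mem_bot.1 h
    exact Algebra.mem_bot.2 ⟨c, by rw [← e.commutes, hc, e.apply_symm_apply]⟩

variable {F : Type u} {L : Type v} [Field F] [Field L] [Algebra F L]

/-- A nontrivial automorphism of a quadratic Galois extension, with its basic properties. -/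
structure IsQuadraticConj (σ : Gal(L/F)) : Prop where
  finrank_eq : Module.finrank F L = 2
  invol : ∀ y, σ (σ y) = y
  fix : ∀ y, σ y = y → ∃ c, algebraMap F L c = y
  ne : ∃ y, σ y ≠ y
  gen : ∀ τ : Gal(L/F), τ ∈ Subgroup.zpowers σ
  uniq : ∀ σ' : Gal(L/F), σ' ≠ 1 → σ' = σ
  norm : ∀ y, algebraMap F L (Algebra.norm F y) = y * σ y

theorem isQuadraticConj [IsGalois F L] (h : Module.finrank F L = 2) (σ : Gal(L/F)) (hσ : σ ≠ 1) :
    IsQuadraticConj σ := by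
  have : FiniteDimensional F L := Module.finite_of_finrank_eq_succ h
  have hcard : Fintype.card Gal(L/F) = 2 := by
    rw [← Nat.card_eq_fintype_card, IsGalois.card_aut_eq_finrank, h]
  classical
  have huniv : (Finset.univ : Finset Gal(L/F)) = {1, σ} := by
    symm
    rw [← Finset.card_eq_iff_eq_univ, Finset.card_pair hσ.symm, hcard]
  have hall : ∀ τ : Gal(L/F), τ = 1 ∨ τ = σ := fun τ => by
    have := Finset.mem_univ τ
    rw [huniv] at this
    simpa using this
  have hinv : σ * σ = 1 := by
    rcases hall (σ * σ) with h | h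
    · exact h
    · exact absurd (mul_eq_left.1 h) hσ
  refine ⟨h, fun y => DFunLike.congr_fun hinv y, fun y hy => ?_, ?_, fun τ => ?_, fun τ hτ => ?_,
    fun y => ?_⟩
  · have : y ∈ (⊥ : IntermediateField F L) := by
      rw [IsGalois.mem_bot_iff_fixed]
      intro τ
      rcases hall τ with rfl | rfl
      · rfl
      · exact hy
    exact IntermediateField.mem_bot.1 this
  · by_contra hcon
    push Not at hcon
    exact hσ (AlgEquiv.ext hcon)
  · rcases hall τ with rfl | rfl
    · exact one_mem _
    · exact Subgroup.mem_zpowers _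
  · exact (hall τ).resolve_left hτ
  · rw [Algebra.norm_eq_prod_automorphisms, huniv, Finset.prod_pair hσ.symm]
    rfl

theorem exists_isQuadraticConj [IsGalois F L] (h : Module.finrank F L = 2) :
    ∃ σ : Gal(L/F), IsQuadraticConj σ := by
  have : FiniteDimensional F L := Module.finite_of_finrank_eq_succ h
  have hcard : Nat.card Gal(L/F) = 2 := by rw [IsGalois.card_aut_eq_finrank, h]
  have : Nontrivial Gal(L/F) := Finite.one_lt_card_iff_nontrivial.1 (by omega)
  obtain ⟨σ, hσ⟩ := exists_ne (1 : Gal(L/F))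
  exact ⟨σ, isQuadraticConj h σ hσ⟩

namespace IsQuadraticConj

variable {σ : Gal(L/F)}

theorem finite (hσ : IsQuadraticConj σ) : FiniteDimensional F L :=
  Module.finite_of_finrank_eq_succ hσ.finrank_eq

variable (hσ : IsQuadraticConj σ)

/-- The cyclic algebra attached to a unit. -/
abbrev alg (a : Fˣ) : Type v := cyclicAlgebra σ hσ.invol (a : F)

theorem alg_finrank (a : Fˣ) : Module.finrank F (hσ.alg a) = 4 :=
  haveI := hσ.finite
  cyclicAlgebra.finrank_eq hσ.finrank_eq

theorem alg_finite (a : Fˣ) : FiniteDimensional F (hσ.alg a) :=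
  Module.finite_of_finrank_eq_succ (hσ.alg_finrank a)

theorem alg_central (a : Fˣ) : Algebra.IsCentral F (hσ.alg a) :=
  cyclicAlgebra.isCentral hσ.invol hσ.fix hσ.ne

theorem alg_simple (a : Fˣ) : IsSimpleRing (hσ.alg a) :=
  cyclicAlgebra.isSimple hσ.invol a.ne_zero hσ.ne

theorem alg_small (a : Fˣ) : Small.{u} (hσ.alg a) := by
  have := hσ.alg_finite a
  exact ⟨_, ⟨(Module.finBasis F (hσ.alg a)).equivFun.toEquiv⟩⟩

/-- The cyclic algebra as a bundled central simple algebra. -/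
noncomputable def csa (a : Fˣ) : CSA.{u, u} F :=
  haveI := hσ.alg_small a
  haveI := hσ.alg_finite a
  haveI := hσ.alg_central a
  haveI := hσ.alg_simple a
  haveI : FiniteDimensional F (Shrink.{u} (hσ.alg a)) :=
    Module.Finite.equiv (Shrink.algEquiv F (hσ.alg a)).symm.toLinearEquiv
  haveI : Algebra.IsCentral F (Shrink.{u} (hσ.alg a)) :=
    isCentral_of_algEquiv (Shrink.algEquiv F (hσ.alg a)).symm
  haveI : IsSimpleRing (Shrink.{u} (hσ.alg a)) :=
    isSimpleRing_of_ringEquiv (Shrink.algEquiv F (hσ.alg a)).symm.toRingEquiv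
  csaOf F (Shrink.{u} (hσ.alg a))

/-- The bundled cyclic algebra is isomorphic to the cyclic algebra. -/
noncomputable def csaEquiv (a : Fˣ) : hσ.csa a ≃ₐ[F] hσ.alg a :=
  haveI := hσ.alg_small a
  Shrink.algEquiv F (hσ.alg a)

/-- The cyclic algebra lies inside the two by two matrices over `L`. The induced map from its base
change is injective by simplicity, and both sides have dimension four over `L`. -/
theorem isSplitOver_csa (a : Fˣ) : IsSplitOver L (hσ.csa a) := by
  have := hσ.alg_finite a
  have := hσ.alg_central a
  have := hσ.alg_simple a
  have : IsSimpleRing (L ⊗[F] hσ.alg a) :=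
    haveI := isSimpleRing_tensor (F := F) (A := hσ.alg a) (B := L)
    isSimpleRing_of_ringEquiv (A := hσ.alg a ⊗[F] L) (Algebra.TensorProduct.comm F (hσ.alg a) L).toRingEquiv
  obtain ⟨e⟩ := nonempty_algEquiv_of_finrank_eq
    (Algebra.TensorProduct.lift (Algebra.ofId L (Matrix (Fin 2) (Fin 2) L))
      (cyclicAlgebra σ hσ.invol (a : F)).val fun _ _ => Algebra.commutes _ _)
    (by rw [Module.finrank_baseChange, hσ.alg_finrank, Module.finrank_matrix]; simp)
  exact ⟨2, two_ne_zero, ⟨(Algebra.TensorProduct.congr AlgEquiv.refl (hσ.csaEquiv a)).trans e⟩⟩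

/-- The class of the cyclic algebra in the relative Brauer group. -/
noncomputable def cls (a : Fˣ) : relBrauerGroup F L :=
  ⟨Quotient.mk _ (hσ.csa a), hσ.csa a, hσ.isSplitOver_csa a, rfl⟩

/-- The defining relations give a map out of the cyclic algebra; simplicity makes it injective and
the dimension count makes it bijective. -/
theorem nonempty_algEquiv_of_relations (a : Fˣ) {A : Type w} [Ring A] [Algebra F A]
    (hA : Module.finrank F A = 4) (j : L →ₐ[F] A) (x : A)
    (hx : ∀ y, x * j y = j (σ y) * x) (hxa : x * x = algebraMap F A a) :
    Nonempty (hσ.alg a ≃ₐ[F] A) := by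
  have := hσ.alg_finite a
  have := hσ.alg_simple a
  have : FiniteDimensional F A := Module.finite_of_finrank_eq_succ hA
  have : Nontrivial A := Module.nontrivial_of_finrank_pos (R := F) (by omega)
  exact nonempty_algEquiv_of_finrank_eq (cyclicAlgebra.lift j x hx hxa)
    (by rw [hσ.alg_finrank, hA])

theorem mk_eq_cls (a : Fˣ) {A : CSA.{u, u} F}
    (hA : Module.finrank F A = 4) (j : L →ₐ[F] A) (x : A)
    (hx : ∀ y, x * j y = j (σ y) * x) (hxa : x * x = algebraMap F A a) :
    (Quotient.mk _ A : BrauerGroup.{u, u} F) = hσ.cls a := by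
  obtain ⟨e⟩ := hσ.nonempty_algEquiv_of_relations a hA j x hx hxa
  exact Quotient.sound (brauerEquivalent_of_algEquiv (e.symm.trans (hσ.csaEquiv a).symm))

theorem alg_relations (a : Fˣ) : ∃ (j : L →ₐ[F] hσ.alg a) (x : hσ.alg a),
    (∀ y, x * j y = j (σ y) * x) ∧ x * x = algebraMap F (hσ.alg a) a := by
  refine ⟨cyclicAlgebra.emb _ _ _, cyclicAlgebra.mk _ _ _ 0 1, fun y => ?_, ?_⟩
  · simp only [cyclicAlgebra.emb_apply, cyclicAlgebra.mk_mul]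
    simp
  · simp only [cyclicAlgebra.algebraMap_eq, cyclicAlgebra.mk_mul]
    simp

theorem csa_finrank (a : Fˣ) : Module.finrank F (hσ.csa a) = 4 := by
  rw [(hσ.csaEquiv a).toLinearEquiv.finrank_eq, hσ.alg_finrank]

theorem csa_relations (a : Fˣ) : ∃ (j : L →ₐ[F] hσ.csa a) (x : hσ.csa a),
    (∀ y, x * j y = j (σ y) * x) ∧ x * x = algebraMap F (hσ.csa a) a := by
  obtain ⟨j, x, hx, hxa⟩ := hσ.alg_relations a
  refine ⟨(hσ.csaEquiv a).symm.toAlgHom.comp j, (hσ.csaEquiv a).symm x, fun y => ?_, ?_⟩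
  · exact (map_mul _ _ _).symm.trans ((congrArg (hσ.csaEquiv a).symm (hx y)).trans (map_mul _ _ _))
  · rw [← map_mul, hxa, AlgEquiv.commutes]

theorem isCyclicClass_iff (a : Fˣ) (x : relBrauerGroup F L) :
    IsCyclicClass a x ↔ x = hσ.cls a := by
  constructor
  · rintro ⟨τ, A, j, x, hτ, hA, hx, hxa, h⟩
    obtain rfl : τ = σ := by
      refine hσ.uniq τ ?_
      rintro rfl
      obtain ⟨y, hy⟩ := hσ.ne
      have := hτ σ
      rw [Subgroup.zpowers_one_eq_bot, Subgroup.mem_bot] at this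
      exact hy (by rw [this]; rfl)
    rw [hσ.finrank_eq] at hA hxa
    rw [sq] at hxa
    exact Subtype.ext (h.trans (hσ.mk_eq_cls a hA j x hx hxa))
  · rintro rfl
    obtain ⟨j, x, hx, hxa⟩ := hσ.csa_relations a
    exact ⟨σ, hσ.csa a, j, x, hσ.gen, by rw [hσ.csa_finrank, hσ.finrank_eq]; rfl, hx,
      by rw [hσ.finrank_eq, sq, hxa], rfl⟩

/-- Rescaling the generator by an element of `L` changes the parameter by a norm. -/
theorem cls_mul_norm (a b : Fˣ) (y : L) (h : (b : F) = a * Algebra.norm F y) :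
    hσ.cls a = hσ.cls b := by
  obtain ⟨j, x, hx, hxa⟩ := hσ.csa_relations a
  refine Subtype.ext (hσ.mk_eq_cls b (hσ.csa_finrank a) j (j y * x) (fun z => ?_) ?_)
  · rw [mul_assoc, hx, ← mul_assoc, ← mul_assoc, ← map_mul, ← map_mul, mul_comm]
  · rw [mul_assoc, ← mul_assoc x, hx, mul_assoc, hxa, ← mul_assoc, ← map_mul, ← hσ.norm,
      AlgHom.commutes, ← map_mul, h, mul_comm]

end IsQuadraticConj

end QuadraticBrauer

end ToricGalois


namespace ToricGalois

/-! ### Multiplicativity of cyclic classes, and the norms as the kernel. -/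

section QuadraticBrauerGroup

universe u v

variable {F : Type u} {L : Type v} [Field F] [Field L] [Algebra F L]

/-- A representation of a matrix algebra over `R` restricts to a representation of `R` on the image
of a primitive idempotent. -/
theorem exists_algHom_corner {R : Type*} [Ring R] [Algebra F R] {p m : ℕ} [NeZero p]
    (f : Matrix (Fin p) (Fin p) R →ₐ[F] Matrix (Fin m) (Fin m) L) :
    ∃ d, p * d = m ∧ Nonempty (R →ₐ[F] Matrix (Fin d) (Fin d) L) := by
  let T : Matrix (Fin p) (Fin p) R →ₐ[F] Module.End L (Fin m → L) :=
    ((Matrix.toLinAlgEquiv' (R := L) (n := Fin m)).toAlgHom.restrictScalars F).comp f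
  let E : Fin p → Fin p → R → Module.End L (Fin m → L) := fun i j r => T (Matrix.single i j r)
  have hE : ∀ i j l r s x, E i j r (E j l s x) = E i l (r * s) x := fun i j l r s x => by
    change (T _ * T _) x = _
    rw [← map_mul, Matrix.single_mul_single_same]
  have hE0 : ∀ i j j' l r s x, j ≠ j' → E i j r (E j' l s x) = 0 := fun i j j' l r s x h => by
    change (T _ * T _) x = _
    rw [← map_mul, Matrix.single_mul_single_of_ne _ _ _ _ h, map_zero]
    rfl
  -- The corner cut out by the idempotent `e₀₀`. The matrix units `e₀ᵢ` and `eᵢ₀` identify the whole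
  -- space with `p` copies of it, whence `p * d = m`.
  let V : Submodule L (Fin m → L) := LinearMap.range (E 0 0 1)
  have hV : ∀ x ∈ V, E 0 0 1 x = x := by
    rintro _ ⟨x, rfl⟩
    rw [hE, one_mul]
  have hEV : ∀ i r x, E 0 i r x ∈ V := fun i r x => ⟨E 0 i r x, by rw [hE, one_mul]⟩
  let g : R →ₐ[F] Module.End L V := AlgHom.ofLinearMap
    { toFun := fun r => (E 0 0 r).restrict fun x _ => hEV 0 r x
      map_add' := fun r s => by
        ext x : 2
        change E 0 0 (r + s) x = E 0 0 r x + E 0 0 s x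
        simp only [E, Matrix.single_add, map_add, LinearMap.add_apply]
      map_smul' := fun c r => by
        ext x : 2
        change E 0 0 (c • r) x = c • E 0 0 r x
        simp only [E, ← Matrix.smul_single, map_smul]
        rfl }
    (LinearMap.ext fun x => Subtype.ext (hV x x.2))
    (fun r s => LinearMap.ext fun x => Subtype.ext (hE 0 0 0 r s x).symm)
  let e : (Fin m → L) ≃ₗ[L] (Fin p → V) := LinearEquiv.ofLinearMap
    (LinearMap.pi fun i => (E 0 i 1).codRestrict V (hEV i 1))
    (∑ i, E i 0 1 ∘ₗ V.subtype ∘ₗ LinearMap.proj i)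
    (by
      refine LinearMap.ext fun y => funext fun i => Subtype.ext ?_
      simp only [LinearMap.comp_apply, LinearMap.sum_apply, LinearMap.pi_apply,
        map_sum, LinearMap.proj_apply, Submodule.subtype_apply, LinearMap.id_apply]
      simp only [AddSubmonoidClass.coe_finsetSum, LinearMap.codRestrict_apply]
      rw [Finset.sum_eq_single i (fun j _ hj => hE0 _ _ _ _ _ _ _ hj.symm) (by simp), hE, one_mul]
      exact hV _ (y i).2)
    (by
      refine LinearMap.ext fun y => ?_
      simp only [LinearMap.comp_apply, LinearMap.sum_apply, LinearMap.pi_apply,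
        LinearMap.codRestrict_apply, LinearMap.proj_apply, Submodule.subtype_apply,
        LinearMap.id_apply, hE, mul_one]
      have h1 : ∑ i, Matrix.single i i (1 : R) = (1 : Matrix (Fin p) (Fin p) R) := by
        ext i j
        simp [Matrix.sum_apply, Matrix.single_apply, Matrix.one_apply, ite_and]
      calc ∑ i, E i i 1 y = (∑ i, E i i 1) y := (LinearMap.sum_apply _ _ _).symm
        _ = T 1 y := by rw [← h1, map_sum]
        _ = y := by rw [map_one]; rfl)
  refine ⟨Module.finrank L V, ?_, ⟨((algEquivMatrix (Module.finBasis L V)).toAlgHom.restrictScalars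
    F).comp g⟩⟩
  have := e.finrank_eq
  rw [Module.finrank_fintype_fun_eq_card, Module.finrank_pi_fintype] at this
  simpa using this.symm

namespace IsQuadraticConj

variable {σ : Gal(L/F)} (hσ : IsQuadraticConj σ)

/-- This is the explicit form of `(a) ⊗ (b) ~ (ab)`: two commuting copies of cyclic algebras, with
parameters `a` and `b`, are exhibited in the two by two matrices over an algebra satisfying the
relations for `ab`. -/
theorem nonempty_algHom_tensor (a b : Fˣ) {C : Type*} [Ring C] [Algebra F C] (j : L →ₐ[F] C) (z : C)
    (hz : ∀ y, z * j y = j (σ y) * z) (hzz : z * z = algebraMap F C (a * b)) :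
    Nonempty (hσ.alg a ⊗[F] hσ.alg b →ₐ[F] Matrix (Fin 2) (Fin 2) C) := by
  let D : L →ₐ[F] Matrix (Fin 2) (Fin 2) C :=
    (Matrix.diagonalAlgHom F).comp (AlgHom.pi ![j, j.comp σ.toAlgHom])
  let D' : L →ₐ[F] Matrix (Fin 2) (Fin 2) C :=
    (Matrix.diagonalAlgHom F).comp (AlgHom.pi ![j, j])
  have hD : ∀ y, D y = !![j y, 0; 0, j (σ y)] := fun y => by
    ext i l
    fin_cases i <;> fin_cases l <;> simp [D]
  have hD' : ∀ y, D' y = !![j y, 0; 0, j y] := fun y => by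
    ext i l
    fin_cases i <;> fin_cases l <;> simp [D']
  have ha : (a : F) ≠ 0 := a.ne_zero
  have hab : (a : F)⁻¹ • (algebraMap F C a * algebraMap F C b) = algebraMap F C b := by
    rw [← map_mul, Algebra.smul_def, ← map_mul, inv_mul_cancel_left₀ ha]
  have haC : ∀ x : C, x * algebraMap F C a = (a : F) • x := fun x => by
    rw [Algebra.smul_def, Algebra.commutes]
  rw [map_mul] at hzz
  -- The factor `a⁻¹` in `w'` turns `z² = ab` into `w'² = b`; with it, `w w'` and `w' w` both equal
  -- the scalar matrix `z`.
  let w : Matrix (Fin 2) (Fin 2) C := !![0, algebraMap F C a; 1, 0]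
  let w' : Matrix (Fin 2) (Fin 2) C := !![0, z; (a : F)⁻¹ • z, 0]
  have hw : ∀ y, w * D y = D (σ y) * w := fun y => by
    rw [hD, hD]
    simp [w, hσ.invol, haC]
  have hw' : ∀ y, w' * D' y = D' (σ y) * w' := fun y => by
    rw [hD', hD']
    simp [w', hz]
  have hww : w * w = algebraMap F _ (a : F) := by
    ext i l
    fin_cases i <;> fin_cases l <;>
      simp [w, Matrix.algebraMap_matrix_apply, Algebra.algebraMap_eq_smul_one]
  have hww' : w' * w' = algebraMap F _ (b : F) := by
    ext i l
    fin_cases i <;> fin_cases l <;> simp [w', Matrix.algebraMap_matrix_apply, hzz, hab]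
  have c1 : ∀ y y', Commute (D y) (D' y') := fun y y' => by
    rw [commute_iff_eq, hD, hD']
    simp [← map_mul, mul_comm]
  have c2 : ∀ y, Commute (D y) w' := fun y => by
    rw [commute_iff_eq, hD]
    simp [w', hz, hσ.invol]
  have c3 : ∀ y, Commute w (D' y) := fun y => by
    rw [commute_iff_eq, hD']
    simp [w, haC]
  have c4 : Commute w w' := by
    rw [commute_iff_eq]
    simp [w, w', haC, ha]
  refine ⟨Algebra.TensorProduct.lift (cyclicAlgebra.lift D w hw hww)
    (cyclicAlgebra.lift D' w' hw' hww') fun x y => ?_⟩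
  obtain ⟨p, q, rfl⟩ := cyclicAlgebra.exists_eq_mk x
  obtain ⟨p', q', rfl⟩ := cyclicAlgebra.exists_eq_mk y
  rw [cyclicAlgebra.lift_mk, cyclicAlgebra.lift_mk]
  exact ((c1 p p').add_right ((c1 p q').mul_right (c2 p))).add_left
    (((c1 q p').mul_left (c3 p')).add_right
      (((c1 q q').mul_left (c3 q')).mul_right ((c2 q).mul_left c4)))

theorem cls_mul (a b : Fˣ) : hσ.cls (a * b) = hσ.cls a * hσ.cls b := by
  have := hσ.alg_finite a
  have := hσ.alg_finite b
  have := hσ.alg_finite (a * b)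
  have := hσ.alg_central a
  have := hσ.alg_simple a
  have := hσ.alg_simple b
  have := hσ.alg_simple (a * b)
  have := isSimpleRing_tensor (F := F) (A := hσ.alg a) (B := hσ.alg b)
  obtain ⟨j, z, hz, hzz⟩ := hσ.alg_relations (a * b)
  obtain ⟨f⟩ := hσ.nonempty_algHom_tensor a b j z hz hzz
  obtain ⟨e⟩ := nonempty_algEquiv_of_finrank_eq (A := hσ.alg a ⊗[F] hσ.alg b)
    (B := Matrix (Fin 2) (Fin 2) (hσ.alg (a * b))) f (by
    rw [Module.finrank_tensorProduct, Module.finrank_matrix, hσ.alg_finrank, hσ.alg_finrank,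
      hσ.alg_finrank]; simp)
  refine Subtype.ext (Eq.symm (Quotient.sound ⟨1, 2, one_ne_zero, two_ne_zero, ⟨?_⟩⟩))
  exact (matrixOneEquiv F (hσ.csa a ⊗[F] hσ.csa b)).trans <|
    (Algebra.TensorProduct.congr (hσ.csaEquiv a) (hσ.csaEquiv b)).trans <|
    e.trans (hσ.csaEquiv (a * b)).symm.mapMatrix

/-- The parametrization of the relative Brauer group of a quadratic extension. -/
noncomputable def clsHom : Fˣ →* relBrauerGroup F L := MonoidHom.mk' hσ.cls hσ.cls_mul

/-- Through `L` the plane `F²` is a line over `L`, generated by `e = (1, 0)`. Writing `x e = y e`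
with `y` in `L`, one gets `a e = x (y e) = σ(y) x e = σ(y) y e`, so `a` is the norm of `y`. -/
theorem exists_norm_of_algHom (a : Fˣ) (f : hσ.alg a →ₐ[F] Matrix (Fin 2) (Fin 2) F) :
    ∃ y : L, Algebra.norm F y = a := by
  obtain ⟨j, x, hx, hxx⟩ := hσ.alg_relations a
  have := hσ.finite
  let g : L →ₗ[F] (Fin 2 → F) :=
    { toFun := fun y => (f (j y)).mulVec ![1, 0]
      map_add' := fun y z => by simp [Matrix.add_mulVec]
      map_smul' := fun c y => by simp [Matrix.smul_mulVec] }
  have hginj : Function.Injective g := by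
    rw [← LinearMap.ker_eq_bot, LinearMap.ker_eq_bot']
    intro y hy
    by_contra hy0
    have h1 : (f (j y⁻¹)).mulVec ((f (j y)).mulVec ![1, 0]) = ![1, 0] := by
      rw [Matrix.mulVec_mulVec, ← map_mul, ← map_mul, inv_mul_cancel₀ hy0, map_one, map_one,
        Matrix.one_mulVec]
    have h2 : (f (j y)).mulVec ![1, 0] = 0 := hy
    rw [h2, Matrix.mulVec_zero] at h1
    exact zero_ne_one (congrFun h1 0)
  have hgsurj := (LinearMap.injective_iff_surjective_of_finrank_eq_finrank (f := g)
    (by rw [hσ.finrank_eq]; simp)).1 hginj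
  obtain ⟨y, hy⟩ := hgsurj ((f x).mulVec ![1, 0])
  refine ⟨y, (algebraMap F L).injective ?_⟩
  apply hginj
  have h3 : g (algebraMap F L a) = (f x).mulVec ((f x).mulVec ![1, 0]) := by
    rw [Matrix.mulVec_mulVec, ← map_mul, hxx]
    change (f (j _)).mulVec _ = _
    rw [j.commutes]
  rw [h3, ← hy, hσ.norm]
  change (f (j (y * σ y))).mulVec _ = (f x).mulVec ((f (j y)).mulVec _)
  rw [Matrix.mulVec_mulVec, ← map_mul, hx, map_mul f, ← Matrix.mulVec_mulVec, ← hy]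
  change _ = (f (j (σ y))).mulVec ((f (j y)).mulVec _)
  rw [Matrix.mulVec_mulVec, ← map_mul f, ← map_mul j, mul_comm]

theorem clsHom_eq_one_iff (a : Fˣ) : hσ.clsHom a = 1 ↔ ∃ y : L, Algebra.norm F y = a := by
  constructor
  · intro h
    obtain ⟨p, m, hp, hm, ⟨e⟩⟩ : IsBrauerEquivalent (hσ.csa a) (csaOf F F) :=
      Quotient.exact (congrArg Subtype.val h)
    have : NeZero p := ⟨hp⟩
    have hfin : Module.finrank F (csaOf F F) = 1 := Module.finrank_self F
    have hd := e.toLinearEquiv.finrank_eq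
    rw [Module.finrank_matrix, Module.finrank_matrix, hσ.csa_finrank, hfin] at hd
    simp only [Fintype.card_fin, mul_one] at hd
    -- Triviality of the class is an isomorphism of matrix algebras of sizes `p` and `m`. Comparing
    -- dimensions gives `4 p² = m²`, so the corner `d = m / p` is two and the cyclic algebra acts on
    -- `F²`.
    obtain ⟨d, hd', ⟨f⟩⟩ := exists_algHom_corner (F := F) (L := F)
      (e.toAlgHom.comp (hσ.csaEquiv a).symm.mapMatrix.toAlgHom)
    obtain rfl : d = 2 := by
      subst hd'
      have h4 : p * p * (d * d) = p * p * 4 := by rw [hd]; ring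
      have := Nat.eq_of_mul_eq_mul_left (by positivity) h4
      nlinarith
    exact hσ.exists_norm_of_algHom a f
  · rintro ⟨y, hy⟩
    have h := hσ.cls_mul_norm 1 a y (by simp [hy])
    change hσ.clsHom 1 = hσ.clsHom a at h
    rw [← h, map_one]

end IsQuadraticConj

end QuadraticBrauerGroup

end ToricGalois


namespace ToricGalois

/-! ### The relative Brauer group in degree at most two. -/

section RelativeBrauerGroup

universe u v

variable {F : Type u} {L : Type v} [Field F] [Field L] [Algebra F L]

theorem mk_eq_one_of_finrank_eq_one {A : CSA.{u, u} F} (hA : Module.finrank F A = 1) :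
    (Quotient.mk _ A : BrauerGroup.{u, u} F) = 1 := by
  obtain ⟨e⟩ := nonempty_algEquiv_of_finrank_eq (Algebra.ofId F A)
    (by rw [hA, Module.finrank_self])
  exact (Quotient.sound (brauerEquivalent_of_algEquiv (A := csaOf F F) e)).symm

/-- A class in the relative Brauer group of `L/F` is represented by a division algebra of dimension
`d²` with a representation of degree `d` over `L`, where `d ≤ [L : F]`. -/
theorem exists_divisionAlgebra [FiniteDimensional F L] (x : relBrauerGroup F L) :
    ∃ (D : Type u) (_ : DivisionRing D) (_ : Algebra F D) (_ : FiniteDimensional F D)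
      (_ : Algebra.IsCentral F D) (d : ℕ), (x : BrauerGroup.{u, u} F) = Quotient.mk _ (csaOf F D) ∧
      Nonempty (D →ₐ[F] Matrix (Fin d) (Fin d) L) ∧ Module.finrank F D = d * d ∧ d ≠ 0 ∧
      d ≤ Module.finrank F L := by
  obtain ⟨_, A, ⟨m, hm, ⟨e⟩⟩, rfl⟩ := x
  have : IsArtinianRing A := IsArtinianRing.of_finite F A
  obtain ⟨p, hp, D, _, _, _, ⟨g⟩⟩ := IsSimpleRing.exists_algEquiv_matrix_divisionRing_finite F A
  have hcen : Algebra.IsCentral F D :=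
    { out := fun x hx => by
        rw [Subalgebra.mem_center_iff] at hx
        have hM : Algebra.IsCentral F (Matrix (Fin p) (Fin p) D) := isCentral_of_algEquiv g
        have h : Matrix.scalar (Fin p) x ∈ Subalgebra.center F (Matrix (Fin p) (Fin p) D) := by
          rw [Subalgebra.mem_center_iff]
          intro M
          ext i l
          simp [hx]
        rw [Algebra.IsCentral.center_eq_bot] at h
        obtain ⟨c, hc⟩ := Algebra.mem_bot.1 h
        refine Algebra.mem_bot.2 ⟨c, ?_⟩
        have h0 := congrFun (congrFun hc 0) 0
        rwa [Matrix.algebraMap_matrix_apply, if_pos rfl, Matrix.scalar_apply,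
          Matrix.diagonal_apply_eq] at h0 }
  -- The splitting of `A` over `L` makes the matrices over `D` act on `Lᵐ`; passing to a corner
  -- leaves an action of `D` itself on `L^d`, where `p d = m`.
  obtain ⟨d, hd, ⟨f⟩⟩ := exists_algHom_corner (F := F) (L := L)
    (((e.toAlgHom.restrictScalars F).comp
      (Algebra.TensorProduct.includeRight : A →ₐ[F] L ⊗[F] A)).comp g.symm.toAlgHom)
  have hd0 : d ≠ 0 := by
    rintro rfl
    exact hm (by simpa using hd.symm)
  have hdim : Module.finrank F D = d * d := by
    have h1 := e.toLinearEquiv.finrank_eq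
    have h2 := g.toLinearEquiv.finrank_eq
    rw [Module.finrank_baseChange, h2, Module.finrank_matrix, Module.finrank_matrix, ← hd] at h1
    simp only [Fintype.card_fin, Module.finrank_self, mul_one] at h1
    refine Nat.eq_of_mul_eq_mul_left (Nat.mul_pos (NeZero.pos p) (NeZero.pos p)) ?_
    rw [h1]
    ring
  refine ⟨D, _, _, ‹_›, hcen, d, ?_, ⟨f⟩, hdim, hd0, ?_⟩
  · refine Quotient.sound ⟨1, p, one_ne_zero, hp.out, ⟨(matrixOneEquiv F A).trans g⟩⟩
  · have : NeZero d := ⟨hd0⟩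
    -- The orbit map of a nonzero vector is injective on a division algebra, so `d² ≤ d [L : F]`.
    let φ : D →ₗ[F] (Fin d → L) :=
      { toFun := fun x => (f x).mulVec (Pi.single 0 1)
        map_add' := fun y z => by rw [map_add, Matrix.add_mulVec]
        map_smul' := fun c y => by rw [map_smul, Matrix.smul_mulVec]; rfl }
    have hφ : Function.Injective φ := by
      rw [← LinearMap.ker_eq_bot, LinearMap.ker_eq_bot']
      intro y hy
      by_contra hy0
      have h1 : (f y⁻¹).mulVec ((f y).mulVec (Pi.single 0 1)) = Pi.single 0 1 := by
        rw [Matrix.mulVec_mulVec, ← map_mul, inv_mul_cancel₀ hy0, map_one, Matrix.one_mulVec]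
      have h2 : (f y).mulVec (Pi.single 0 1) = 0 := hy
      rw [h2, Matrix.mulVec_zero] at h1
      simpa using congrFun h1 0
    have h := LinearMap.finrank_le_finrank_of_injective hφ
    rw [hdim, Module.finrank_pi_fintype] at h
    simp only [Finset.sum_const, Finset.card_univ, Fintype.card_fin, smul_eq_mul] at h
    exact Nat.le_of_mul_le_mul_left h (Nat.pos_of_ne_zero hd0)

theorem relBrauerGroup_eq_one [FiniteDimensional F L] (h : Module.finrank F L = 1)
    (x : relBrauerGroup F L) : x = 1 := by
  obtain ⟨D, _, _, _, _, d, hx, -, hD, hd0, hd⟩ := exists_divisionAlgebra x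
  obtain rfl : d = 1 := by omega
  exact Subtype.ext (hx.trans (mk_eq_one_of_finrank_eq_one hD))

/-- A division algebra of dimension four with a representation of degree two over `L` contains a
copy of `L`. -/
theorem exists_embedding {D : Type*} [DivisionRing D] [Algebra F D]
    (hL : Module.finrank F L = 2) (hD : Module.finrank F D = 4)
    (f : D →ₐ[F] Matrix (Fin 2) (Fin 2) L) : Nonempty (L →ₐ[F] D) := by
  have : FiniteDimensional F L := Module.finite_of_finrank_eq_succ hL
  have : FiniteDimensional F D := Module.finite_of_finrank_eq_succ hD
  let v : Fin 2 → L := ![1, 0]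
  let φ : D →ₗ[F] (Fin 2 → L) :=
    { toFun := fun x => (f x).mulVec v
      map_add' := fun y z => by simp [Matrix.add_mulVec]
      map_smul' := fun c y => by simp [Matrix.smul_mulVec] }
  have hφ : Function.Injective φ := by
    rw [← LinearMap.ker_eq_bot, LinearMap.ker_eq_bot']
    intro y hy
    by_contra hy0
    have h1 : (f y⁻¹).mulVec ((f y).mulVec v) = v := by
      rw [Matrix.mulVec_mulVec, ← map_mul, inv_mul_cancel₀ hy0, map_one, Matrix.one_mulVec]
    have h2 : (f y).mulVec v = 0 := hy
    rw [h2, Matrix.mulVec_zero] at h1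
    exact zero_ne_one (congrFun h1 0)
  -- By dimension the orbit map of `v` is bijective. Sending `y` to the unique element of `D` that
  -- acts on `v` as `y` is multiplicative, because `D` acts `L`-linearly.
  let e : D ≃ₗ[F] (Fin 2 → L) := LinearEquiv.ofInjectiveOfFinrankEq φ hφ (by
    rw [hD, Module.finrank_pi_fintype]; simp [hL])
  have he : ∀ x, e x = (f x).mulVec v := fun x => rfl
  have hs : ∀ y : L, (f (e.symm (y • v))).mulVec v = y • v := fun y => by
    rw [← he, e.apply_symm_apply]
  refine ⟨AlgHom.ofLinearMap
    { toFun := fun y => e.symm (y • v)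
      map_add' := fun y z => by rw [add_smul, map_add]
      map_smul' := fun c y => by rw [smul_assoc, map_smul]; rfl } ?_ fun y z => ?_⟩
  · change e.symm _ = _
    rw [LinearEquiv.symm_apply_eq, he, map_one, Matrix.one_mulVec, one_smul]
  · change e.symm _ = e.symm _ * e.symm _
    rw [LinearEquiv.symm_apply_eq, he, map_mul, ← Matrix.mulVec_mulVec, hs, Matrix.mulVec_smul, hs,
      smul_smul, mul_comm]

namespace IsQuadraticConj

variable {σ : Gal(L/F)}

/-- An embedding of a quadratic extension in a division algebra of dimension four can be completed
to a presentation as a cyclic algebra. -/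
theorem exists_relations (hσ : IsQuadraticConj σ) {D : Type*} [DivisionRing D] [Algebra F D] [Algebra.IsCentral F D]
    (hD : Module.finrank F D = 4) (ψ : L →ₐ[F] D) :
    ∃ (w : D) (c : Fˣ), (∀ y, w * ψ y = ψ (σ y) * w) ∧ w * w = algebraMap F D c := by
  have := hσ.finite
  have : FiniteDimensional F D := Module.finite_of_finrank_eq_succ hD
  obtain ⟨θ, hθ⟩ := hσ.ne
  have hcen : ∀ z : D, (∀ u, u * z = z * u) → ∃ c, algebraMap F D c = z := fun z hz => by
    have h : z ∈ Subalgebra.center F D := Subalgebra.mem_center_iff.2 hz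
    rw [Algebra.IsCentral.center_eq_bot] at h
    exact Algebra.mem_bot.1 h
  obtain ⟨u, hu⟩ : ∃ u : D, u * ψ θ ≠ ψ θ * u := by
    by_contra hcon
    push Not at hcon
    obtain ⟨c, hc⟩ := hcen _ hcon
    rw [← ψ.commutes] at hc
    rw [← ψ.toRingHom.injective hc, AlgEquiv.commutes] at hθ
    exact hθ rfl
  -- A commutator with `θ` automatically conjugates `θ` to `σ θ`, since the trace `θ + σ θ` and the
  -- norm `σ θ * θ` are central.
  let w : D := u * ψ θ - ψ θ * u
  have hw0 : w ≠ 0 := sub_ne_zero.2 hu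
  have hfix : ∀ y, σ y = y → ∀ z, z * ψ y = ψ y * z := fun y hy z => by
    obtain ⟨c, rfl⟩ := hσ.fix y hy
    rw [ψ.commutes, Algebra.commutes]
  have hwθ : w * ψ θ = ψ (σ θ) * w := by
    have h1 := hfix (θ + σ θ) (by rw [map_add, hσ.invol, add_comm]) u
    have h2 := hfix (σ θ * θ) (by rw [map_mul, hσ.invol, mul_comm]) u
    rw [map_add] at h1
    rw [map_mul] at h2
    have h3 : w * ψ θ - ψ (σ θ) * w = (u * (ψ θ + ψ (σ θ)) - (ψ θ + ψ (σ θ)) * u) * ψ θ -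
        (u * (ψ (σ θ) * ψ θ) - ψ (σ θ) * ψ θ * u) := by
      simp only [w]
      noncomm_ring
    rw [h1, h2, sub_self, sub_self, zero_mul, sub_zero] at h3
    exact sub_eq_zero.1 h3
  have hθ' : σ θ - θ ≠ 0 := sub_ne_zero.2 hθ
  have hw : ∀ y, w * ψ y = ψ (σ y) * w := fun y => by
    -- The coefficient of `θ` when `y` is written as `e θ + c` with `e` and `c` fixed by `σ`; the
    -- relation then extends from `θ` to `y`.
    let e := (σ y - y) / (σ θ - θ)
    have he : σ e = e := by
      simp only [e, map_div₀, map_sub, hσ.invol]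
      rw [← neg_sub (σ y), ← neg_sub (σ θ), neg_div_neg_eq]
    have hy : y = e * θ + (y - e * θ) := by ring
    have hc : σ (y - e * θ) = y - e * θ := by
      rw [map_sub, map_mul, he]
      have : e * (σ θ - θ) = σ y - y := div_mul_cancel₀ _ hθ'
      linear_combination -this
    rw [hy, map_add, map_mul ψ, mul_add, hfix _ hc, ← mul_assoc, hfix _ he, mul_assoc, hwθ,
      ← mul_assoc, ← map_mul, ← add_mul, ← map_add, map_add σ, map_mul σ, he, hc]
  let g : (L × L) →ₗ[F] D :=
    { toFun := fun x => ψ x.1 + ψ x.2 * w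
      map_add' := fun x y => by simp [add_mul]; abel
      map_smul' := fun c x => by simp }
  have hg : Function.Injective g := by
    rw [← LinearMap.ker_eq_bot, LinearMap.ker_eq_bot']
    rintro ⟨p, q⟩ h
    change ψ p + ψ q * w = 0 at h
    have hq : q = 0 := by
      by_contra hq
      have h1 : w = ψ (-(q⁻¹ * p)) := by
        have h2 : ψ q⁻¹ * (ψ p + ψ q * w) = 0 := by rw [h, mul_zero]
        rw [mul_add, ← mul_assoc, ← map_mul, ← map_mul, inv_mul_cancel₀ hq, map_one, one_mul] at h2
        rw [map_neg]
        exact eq_neg_of_add_eq_zero_right h2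
      have h3 : ψ (σ θ - θ) * w = 0 := by
        rw [map_sub, sub_mul, ← hwθ, sub_eq_zero, h1, ← map_mul, ← map_mul, mul_comm]
      rcases mul_eq_zero.1 h3 with h4 | h4
      · exact hθ' (ψ.toRingHom.injective (h4.trans (map_zero ψ).symm))
      · exact hw0 h4
    subst hq
    rw [map_zero, zero_mul, add_zero] at h
    rw [ψ.toRingHom.injective (h.trans (map_zero ψ).symm)]
    rfl
  have hgs := (LinearMap.injective_iff_surjective_of_finrank_eq_finrank (f := g)
    (by rw [Module.finrank_prod, hσ.finrank_eq, hD])).1 hg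
  -- By dimension `D = L ⊕ L w`. The square of `w` commutes with `L`, as `σ` is an involution, and
  -- with `w`, hence is central.
  obtain ⟨c, hc⟩ := hcen (w * w) fun z => by
    obtain ⟨⟨p, q⟩, rfl⟩ := hgs z
    have h1 : ∀ y, w * w * ψ y = ψ y * (w * w) := fun y => by
      rw [mul_assoc, hw, ← mul_assoc, hw, hσ.invol, mul_assoc]
    change (ψ p + ψ q * w) * (w * w) = w * w * (ψ p + ψ q * w)
    rw [mul_add, add_mul, h1, ← mul_assoc (w * w), h1]
    simp only [mul_assoc]
  have hc0 : c ≠ 0 := by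
    rintro rfl
    rw [map_zero] at hc
    exact mul_ne_zero hw0 hw0 hc.symm
  exact ⟨w, Units.mk0 c hc0, hw, hc.symm⟩

/-- The underlying division algebra of a split class has degree one or two; in degree two it
contains `L`, and therefore is cyclic. -/
theorem clsHom_surjective (hσ : IsQuadraticConj σ) : Function.Surjective hσ.clsHom := fun x => by
  have := hσ.finite
  obtain ⟨D, _, _, _, _, d, hx, ⟨f⟩, hD, hd0, hd⟩ := exists_divisionAlgebra x
  rw [hσ.finrank_eq] at hd
  obtain rfl | rfl : d = 1 ∨ d = 2 := by omega
  · refine ⟨1, ?_⟩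
    rw [map_one]
    exact (Subtype.ext (hx.trans (mk_eq_one_of_finrank_eq_one hD))).symm
  · obtain ⟨ψ⟩ := exists_embedding hσ.finrank_eq hD f
    obtain ⟨w, c, hw, hc⟩ := hσ.exists_relations hD ψ
    exact ⟨c, Subtype.ext ((hσ.mk_eq_cls c (A := csaOf F D) hD ψ w hw hc).symm.trans hx.symm)⟩

end IsQuadraticConj

/-- For a Galois extension `L/F` of degree at most two, the relative Brauer group is the quotient
of `Fˣ` by the norms from `L`, by means of the classes of the cyclic algebras. -/
theorem exists_relBrauerGroup_parametrization [FiniteDimensional F L] [IsGalois F L]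
    (h : Module.finrank F L ≤ 2) :
    ∃ β : Fˣ →* relBrauerGroup F L, Function.Surjective β ∧
      (∀ a, β a = 1 ↔ ∃ y : L, Algebra.norm F y = a) ∧ ∀ a x, IsCyclicClass a x ↔ x = β a := by
  have hpos : 0 < Module.finrank F L := Module.finrank_pos
  obtain h1 | h2 : Module.finrank F L = 1 ∨ Module.finrank F L = 2 := by omega
  · have hbij : Function.Bijective (algebraMap F L) :=
      Algebra.bijective_algebraMap_iff.2 (Subalgebra.bot_eq_top_iff_finrank_eq_one.2 h1).symm
    refine ⟨1, fun x => ⟨1, (relBrauerGroup_eq_one h1 x).symm⟩, fun a => ?_, fun a x => ?_⟩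
    · refine ⟨fun _ => ⟨algebraMap F L a, ?_⟩, fun _ => rfl⟩
      rw [Algebra.norm_algebraMap, h1, pow_one]
    · refine ⟨fun _ => relBrauerGroup_eq_one h1 x, fun hx => ?_⟩
      have : Subsingleton Gal(L/F) := ⟨fun τ τ' => AlgEquiv.ext fun y => by
        obtain ⟨c, rfl⟩ := hbij.2 y
        rw [τ.commutes, τ'.commutes]⟩
      -- In degree one the cyclic algebra is `F` itself, with `w = a`.
      refine ⟨1, csaOf F F, (AlgEquiv.ofBijective (Algebra.ofId F L) hbij).symm.toAlgHom,
        (a : F), fun τ => ?_, ?_, fun y => ?_, ?_, ?_⟩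
      · rw [Subsingleton.elim τ 1]
        exact one_mem _
      · rw [h1]
        exact Module.finrank_self F
      · exact mul_comm (a : F) _
      · rw [h1]
        exact pow_one (a : F)
      · rw [hx]
        rfl
  · obtain ⟨σ, hσ⟩ := exists_isQuadraticConj (F := F) (L := L) h2
    exact ⟨hσ.clsHom, hσ.clsHom_surjective, hσ.clsHom_eq_one_iff, hσ.isCyclicClass_iff⟩

end RelativeBrauerGroup

end ToricGalois


namespace ToricGalois

/-! ### Fixed fields, quadratic characters and norms. -/

section GaloisNorm

universe u v

theorem isGalois_of_finrank_le_two {F L : Type*} [Field F] [Field L] [Algebra F L]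
    [FiniteDimensional F L] [Algebra.IsSeparable F L] (h : Module.finrank F L ≤ 2) :
    IsGalois F L := by
  have hpos : 0 < Module.finrank F L := Module.finrank_pos
  obtain h1 | h2 : Module.finrank F L = 1 ∨ Module.finrank F L = 2 := by omega
  · have hbij : Function.Bijective (algebraMap F L) :=
      Algebra.bijective_algebraMap_iff.2 (Subalgebra.bot_eq_top_iff_finrank_eq_one.2 h1).symm
    exact IsGalois.of_algEquiv (AlgEquiv.ofBijective (Algebra.ofId F L) hbij)
  · have : Algebra.IsQuadraticExtension F L := ⟨h2⟩
    infer_instance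

theorem mem_of_forall_fixedField {k : Type u} {K : Type v} [Field k] [Field K] [Algebra k K]
    [FiniteDimensional k K] (H : Subgroup Gal(K/k)) (g : Gal(K/k))
    (h : ∀ z ∈ IntermediateField.fixedField H, g z = z) : g ∈ H := by
  rw [← IntermediateField.fixingSubgroup_fixedField H, IntermediateField.mem_fixingSubgroup_iff]
  exact h

/-- An element of a subgroup is an automorphism over the fixed field. -/
def toFixedAut {k : Type u} {K : Type v} [Field k] [Field K] [Algebra k K]
    (H : Subgroup Gal(K/k)) (h : H) : Gal(K/IntermediateField.fixedField H) :=
  AlgEquiv.ofRingEquiv (f := (h : Gal(K/k)).toRingEquiv) fun a => a.2 h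

theorem exists_mem_eq_restrictScalars {k : Type u} {K : Type v} [Field k] [Field K] [Algebra k K]
    [FiniteDimensional k K] (H : Subgroup Gal(K/k))
    (τ : Gal(K/IntermediateField.fixedField H)) : ∃ h : H, τ = toFixedAut H h := by
  have : τ.restrictScalars k ∈ H :=
    mem_of_forall_fixedField H _ fun z hz => τ.commutes ⟨z, hz⟩
  exact ⟨⟨_, this⟩, rfl⟩

/-- Hilbert's theorem 90 for a subgroup of the Galois group. -/
theorem hilbert90_subgroup {k : Type u} {K : Type v} [Field k] [Field K] [Algebra k K]
    [FiniteDimensional k K] (H : Subgroup Gal(K/k)) (c : Gal(K/k) → Kˣ)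
    (hc : ∀ g ∈ H, ∀ h ∈ H, c (g * h) = g • c h * c g) :
    ∃ x : Kˣ, ∀ h ∈ H, c h = h • x / x := by
  obtain ⟨x, hx⟩ := groupCohomology.isMulCoboundary₁_of_isMulCocycle₁_of_aut_to_units
    (K := IntermediateField.fixedField H) (L := K) (fun τ => c (τ.restrictScalars k))
    (fun τ τ' => by
      obtain ⟨g, rfl⟩ := exists_mem_eq_restrictScalars H τ
      obtain ⟨h, rfl⟩ := exists_mem_eq_restrictScalars H τ'
      exact hc g g.2 h h.2)
  exact ⟨x, fun h hh => (hx (toFixedAut H ⟨h, hh⟩)).symm⟩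

section Fixed

variable {k : Type u} {K : Type v} [Field k] [Field K] [Algebra k K] [FiniteDimensional k K]
  [IsGalois k K]

/-- The relative Brauer group of the extension cut out by a quadratic character. -/
theorem exists_relBrauerGroup_parametrization_character (χ : Gal(K/k) →* ℤˣ)
    (M : IntermediateField k K) (hM : ∀ y, y ∈ M ↔ ∀ g, χ g = 1 → g y = y) :
    ∃ β : kˣ →* relBrauerGroup k M, Function.Surjective β ∧
      (∀ a x, IsCyclicClass a x ↔ x = β a) ∧ ∀ a, β a = 1 ↔ ∃ x : Kˣ, ∀ g : Gal(K/k),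
        if χ g = 1 then g • x = x else Units.map (algebraMap k K : k →* K) a = x * g • x := by
  have hMker : M = IntermediateField.fixedField χ.ker := by
    ext y
    rw [hM, IntermediateField.mem_fixedField_iff]
    rfl
  have hfix : M.fixingSubgroup = χ.ker := by
    rw [hMker, IntermediateField.fixingSubgroup_fixedField]
  have hfin : Module.finrank k M ≤ 2 := by
    rw [IntermediateField.finrank_eq_fixingSubgroup_index, hfix, Subgroup.index_ker]
    exact (Finite.card_subtype_le _).trans (by simp)
  have := isGalois_of_finrank_le_two hfin
  obtain ⟨β, hβs, hβ1, hβ⟩ := exists_relBrauerGroup_parametrization hfin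
  refine ⟨β, hβs, hβ, fun a => ?_⟩
  rw [hβ1]
  by_cases htriv : ∀ g, χ g = 1
  -- For a trivial character both conditions hold for every `a`: the norm from `M` is the identity,
  -- and on the other side `x = 1` serves.
  · have h1 : Module.finrank k M = 1 := by
      rw [IntermediateField.finrank_eq_fixingSubgroup_index, hfix,
        (MonoidHom.ker_eq_top_iff).2 (MonoidHom.ext htriv), Subgroup.index_top]
    refine ⟨fun _ => ⟨1, fun g => ?_⟩, fun _ => ⟨algebraMap k M a, ?_⟩⟩
    · rw [if_pos (htriv g), smul_one]
    · rw [Algebra.norm_algebraMap, h1, pow_one]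
  · push Not at htriv
    obtain ⟨σ, hσ⟩ := htriv
    have hσ' : σ.restrictNormal M ≠ 1 := by
      intro h
      refine hσ ?_
      change σ ∈ χ.ker
      rw [← hfix, IntermediateField.mem_fixingSubgroup_iff]
      intro y hy
      have := σ.restrictNormal_commutes M ⟨y, hy⟩
      rw [h] at this
      exact this.symm
    have hpos : 0 < Module.finrank k M := Module.finrank_pos
    have h2 : Module.finrank k M = 2 := by
      by_contra hne
      have h1 : Module.finrank k M = 1 := by omega
      have hc : Nat.card Gal(M/k) = 1 := by rw [IsGalois.card_aut_eq_finrank, h1]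
      have := (Nat.card_eq_one_iff_unique.1 hc).1
      exact hσ' (Subsingleton.elim _ _)
    have hnorm : ∀ y : M, algebraMap k K (Algebra.norm k y) = y * σ y := fun y => by
      have h := congrArg (algebraMap M K) ((isQuadraticConj h2 _ hσ').norm y)
      rw [← IsScalarTower.algebraMap_apply, map_mul, σ.restrictNormal_commutes] at h
      exact h
    constructor
    · rintro ⟨y, hy⟩
      have hy0 : (y : K) ≠ 0 := by
        rintro h0
        obtain rfl : y = 0 := Subtype.ext h0
        rw [Algebra.norm_zero] at hy
        exact a.ne_zero hy.symm
      refine ⟨Units.mk0 y hy0, fun g => ?_⟩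
      have hyM := (hM y).1 y.2
      split_ifs with hg
      · exact Units.ext (hyM g hg)
      · refine Units.ext ?_
        -- Two elements outside the kernel of `χ` differ by an element of the kernel, so they agree
        -- on `M`.
        have h1 : χ (σ⁻¹ * g) = 1 := by
          rw [map_mul, map_inv, (Int.units_eq_one_or _).resolve_left hg,
            (Int.units_eq_one_or _).resolve_left hσ]
          simp
        have h2 : g (y : K) = σ y := by
          conv_rhs => rw [← hyM _ h1]
          rw [← AlgEquiv.mul_apply, mul_inv_cancel_left]
        change algebraMap k K a = y * g y
        rw [h2, ← hnorm, hy]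
    · rintro ⟨x, hx⟩
      have hxM : (x : K) ∈ M := (hM x).2 fun g hg => by
        have := hx g
        rw [if_pos hg] at this
        exact congrArg Units.val this
      refine ⟨⟨x, hxM⟩, (algebraMap k K).injective ?_⟩
      have := hx σ
      rw [if_neg hσ] at this
      rw [hnorm]
      exact (congrArg Units.val this).symm

/-- The norm from a fixed field is the product over the cosets. -/
theorem norm_fixedField (H : Subgroup Gal(K/k)) [Fintype (Gal(K/k) ⧸ H)]
    (a : IntermediateField.fixedField H) :
    algebraMap k K (Algebra.norm k a) = ∏ x : Gal(K/k) ⧸ H, x.out (a : K) := by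
  let F := IntermediateField.fixedField H
  let Ω := AlgebraicClosure K
  -- The embeddings of the fixed field are the coset representatives: distinct cosets restrict
  -- differently, and the index of `H` equals the degree.
  let Φ : (Gal(K/k) ⧸ H) → (F →ₐ[k] Ω) := fun x =>
    (IsScalarTower.toAlgHom k K Ω).comp (x.out.toAlgHom.comp F.val)
  have hΦ : Function.Bijective Φ := by
    rw [Fintype.bijective_iff_injective_and_card]
    constructor
    · intro x y h
      have h1 : ∀ z : F, x.out (z : K) = y.out (z : K) := fun z =>
        (algebraMap K Ω).injective (DFunLike.congr_fun h z)
      rw [← x.out_eq', ← y.out_eq']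
      refine QuotientGroup.eq.2 (mem_of_forall_fixedField H _ fun z hz => ?_)
      rw [AlgEquiv.mul_apply, ← h1 ⟨z, hz⟩, ← AlgEquiv.mul_apply, inv_mul_cancel]
      rfl
    · rw [AlgHom.card, IntermediateField.finrank_eq_fixingSubgroup_index,
        IntermediateField.fixingSubgroup_fixedField, ← Nat.card_eq_fintype_card]
      rfl
  apply (algebraMap K Ω).injective
  rw [← IsScalarTower.algebraMap_apply, Algebra.norm_eq_prod_embeddings k Ω, map_prod,
    ← hΦ.prod_comp]
  rfl

end Fixed

end GaloisNorm

end ToricGalois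


namespace ToricGalois

/-! ### Twisted units, coinduction, Shapiro's lemma and the norm map. -/

section TwistedCohomology

variable {k K : Type*} [Field k] [Field K] [Algebra k K]

/-- The action of the Galois group on `Kˣ` twisted by a quadratic character. -/
def twist (χ : Gal(K/k) →* ℤˣ) (g : Gal(K/k)) : Kˣ →* Kˣ where
  toFun x := (g • x) ^ ((χ g : ℤˣ) : ℤ)
  map_one' := by simp
  map_mul' x y := by rw [smul_mul', mul_zpow]

variable (χ : Gal(K/k) →* ℤˣ)

theorem twist_apply (g : Gal(K/k)) (x : Kˣ) : twist χ g x = (g • x) ^ ((χ g : ℤˣ) : ℤ) := rfl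

theorem twist_mul (g h : Gal(K/k)) (x : Kˣ) : twist χ (g * h) x = twist χ g (twist χ h x) := by
  rw [twist_apply, twist_apply, twist_apply, map_mul, Units.val_mul, mul_smul, smul_zpow',
    ← zpow_mul, mul_comm]

theorem twist_one (x : Kˣ) : twist χ 1 x = x := by
  rw [twist_apply, map_one, one_smul, Units.val_one, zpow_one]

theorem twist_inv_twist (g : Gal(K/k)) (x : Kˣ) : twist χ g⁻¹ (twist χ g x) = x := by
  rw [← twist_mul, inv_mul_cancel, twist_one]

theorem twist_of_eq_one {g : Gal(K/k)} (hg : χ g = 1) (x : Kˣ) : twist χ g x = g • x := by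
  rw [twist_apply, hg, Units.val_one, zpow_one]

theorem twist_of_ne_one {g : Gal(K/k)} (hg : χ g ≠ 1) (x : Kˣ) : twist χ g x = (g • x)⁻¹ := by
  rw [twist_apply, (Int.units_eq_one_or _).resolve_left hg]
  simp

variable (N : Subgroup Gal(K/k))

/-- The coinduced module: functions `f` on the Galois group with `f (g h) = h⁻¹ f(g)` for `h` in
the subgroup `N`, where `N` acts by the twisted action. -/
def coind : Subgroup (Gal(K/k) → Kˣ) where
  carrier := {f | ∀ g, ∀ h ∈ N, f (g * h) = twist χ h⁻¹ (f g)}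
  one_mem' g h _ := by simp
  mul_mem' {f f'} hf hf' g h hh := by simp [hf g h hh, hf' g h hh]
  inv_mem' {f} hf g h hh := by simp [hf g h hh]

variable {χ N}

theorem coind_translate {f : Gal(K/k) → Kˣ} (hf : f ∈ coind χ N) (g : Gal(K/k)) :
    (fun z => f (g⁻¹ * z)) ∈ coind χ N := fun z h hh => by
  change f (g⁻¹ * (z * h)) = _
  rw [← mul_assoc]
  exact hf _ h hh

/-- Shapiro's lemma: a cocycle in the coinduced module is trivial if its value at `1` is a
coboundary on `N`. -/
theorem exists_coboundary_coind (C : Gal(K/k) → Gal(K/k) → Kˣ) (hC : ∀ g, C g ∈ coind χ N)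
    (hCm : ∀ g h z, C (g * h) z = C h (g⁻¹ * z) * C g z) (x : Kˣ)
    (hx : ∀ h ∈ N, C h 1 = twist χ h x / x) :
    ∃ b ∈ coind χ N, ∀ g z, C g z = b (g⁻¹ * z) / b z := by
  -- Evaluating `C g z = b (g⁻¹ z) / b z` at `z = g` with `b 1 = x` leaves this as the only
  -- candidate. The hypothesis on `N` puts it in the coinduced module.
  refine ⟨fun g => x / C g g, fun g h hh => ?_, fun g z => ?_⟩
  · have h1 : C h h = x / twist χ h⁻¹ x := by
      have := hC h 1 h hh
      rw [one_mul] at this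
      rw [this, hx h hh, map_div, twist_inv_twist]
    change x / C (g * h) (g * h) = _
    rw [hCm, inv_mul_cancel_left, h1, hC g g h hh, map_div]
    rw [div_mul_eq_mul_div, div_div_eq_mul_div, mul_div_mul_left_eq_div]
  · have h := hCm g (g⁻¹ * z) z
    rw [mul_inv_cancel_left] at h
    change C g z = x / C (g⁻¹ * z) (g⁻¹ * z) / (x / C z z)
    rw [h, div_div_div_cancel_left, mul_div_cancel_left]

variable (χ) in
/-- The elementary cocycle with values in the coinduced module attached to an element `a`. -/
def elemCocycle (a : Kˣ) (g z : Gal(K/k)) : Kˣ := if χ g = 1 then 1 else a ^ ((χ z : ℤˣ) : ℤ)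

theorem elemCocycle_mem {a : Kˣ} (ha : ∀ h ∈ N, h • a = a) (g : Gal(K/k)) :
    elemCocycle χ a g ∈ coind χ N := fun z h hh => by
  unfold elemCocycle
  split_ifs with hg
  · rw [map_one]
  · rw [twist_apply, smul_zpow', ha _ (inv_mem hh), ← zpow_mul, map_mul, map_inv, Int.units_inv_eq_self,
      Units.val_mul]

theorem elemCocycle_mul (a : Kˣ) (g h z : Gal(K/k)) :
    elemCocycle χ a (g * h) z = elemCocycle χ a h (g⁻¹ * z) * elemCocycle χ a g z := by
  unfold elemCocycle
  simp only [map_mul, map_inv]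
  rcases Int.units_eq_one_or (χ g) with hg | hg <;> rcases Int.units_eq_one_or (χ h) with hh | hh <;>
    simp [hg, hh]

theorem elemCocycle_mul_left (a a' : Kˣ) (g z : Gal(K/k)) :
    elemCocycle χ (a * a') g z = elemCocycle χ a g z * elemCocycle χ a' g z := by
  unfold elemCocycle
  split_ifs <;> simp [mul_zpow]

/-- A twisted cocycle on a subgroup is cohomologous to an elementary one. -/
theorem exists_elemCocycle [FiniteDimensional k K] (γ : Gal(K/k) → Kˣ)
    (hγ : ∀ g ∈ N, ∀ h ∈ N, γ (g * h) = twist χ g (γ h) * γ g) :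
    ∃ a x : Kˣ, (∀ h ∈ N, h • a = a) ∧
      ∀ h ∈ N, γ h = elemCocycle χ a h 1 * (twist χ h x / x) := by
  obtain ⟨x, hx⟩ := hilbert90_subgroup (χ.ker ⊓ N) γ fun g hg h hh => by
    rw [hγ g hg.2 h hh.2, twist_of_eq_one χ hg.1]
  -- After Hilbert 90 the cocycle is trivial on `N ∩ ker χ`, so it is constant on the other coset;
  -- that constant is the required `a`, and the cocycle identity makes it fixed by `N`.
  let δ : Gal(K/k) → Kˣ := fun h => γ h / (twist χ h x / x)
  have hδ : ∀ g ∈ N, ∀ h ∈ N, δ (g * h) = twist χ g (δ h) * δ g := fun g hg h hh => by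
    simp only [δ]
    rw [hγ g hg h hh, twist_mul, map_div, map_div]
    rw [div_mul_div_comm, div_mul_div_cancel]
  have hδ1 : ∀ h ∈ N, χ h = 1 → δ h = 1 := fun h hh h1 => by
    simp only [δ]
    rw [hx h ⟨h1, hh⟩, twist_of_eq_one χ h1, div_self']
  have key : ∀ h, γ h = δ h * (twist χ h x / x) := fun h => (div_mul_cancel _ _).symm
  by_cases hN : ∀ h ∈ N, χ h = 1
  -- If `χ` is trivial on `N` there is no other coset and the parameter is irrelevant.
  · refine ⟨1, x, fun h _ => smul_one h, fun h hh => ?_⟩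
    rw [key, hδ1 h hh (hN h hh), elemCocycle, if_pos (hN h hh)]
  push Not at hN
  obtain ⟨σ, hσ, hσ1⟩ := hN
  have hinv : ∀ g h, χ g ≠ 1 → χ h ≠ 1 → χ (g * h) = 1 := fun g h hg hh => by
    rw [map_mul, (Int.units_eq_one_or _).resolve_left hg, (Int.units_eq_one_or _).resolve_left hh]
    rfl
  have hσi : χ σ⁻¹ ≠ 1 := by rwa [map_inv, Int.units_inv_eq_self]
  have hval : ∀ h ∈ N, χ h ≠ 1 → δ h = δ σ := fun h hh h1 => by
    have := hδ σ hσ (σ⁻¹ * h) (mul_mem (inv_mem hσ) hh)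
    rwa [mul_inv_cancel_left, hδ1 _ (mul_mem (inv_mem hσ) hh) (hinv _ _ hσi h1), map_one,
      one_mul] at this
  refine ⟨δ σ, x, fun h hh => ?_, fun h hh => ?_⟩
  · have h2 := hδ h hh σ hσ
    by_cases h1 : χ h = 1
    · rw [hval (h * σ) (mul_mem hh hσ) (by rwa [map_mul, h1, one_mul]), twist_of_eq_one χ h1,
        hδ1 h hh h1, mul_one] at h2
      exact h2.symm
    · rw [hδ1 _ (mul_mem hh hσ) (hinv _ _ h1 hσ1), twist_of_ne_one χ h1, hval h hh h1] at h2
      exact (inv_mul_eq_one.1 h2.symm)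
  · rw [key, elemCocycle]
    split_ifs with h1
    · rw [hδ1 h hh h1]
    · rw [hval h hh h1, map_one, Units.val_one, zpow_one]

/-- The summand of the norm of a function does not depend on the representative of the coset. -/
theorem twist_coind {f : Gal(K/k) → Kˣ} (hf : f ∈ coind χ N) {x y : Gal(K/k)}
    (h : (x : Gal(K/k) ⧸ N) = y) : twist χ x (f x) = twist χ y (f y) := by
  have h1 := hf x (x⁻¹ * y) (QuotientGroup.eq.1 h)
  rw [mul_inv_cancel_left] at h1
  rw [h1, ← twist_mul]
  simp

variable [Fintype (Gal(K/k) ⧸ N)]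

variable (χ N) in
/-- The norm from the coinduced module to the twisted module `Kˣ`. -/
noncomputable def coindNorm : (Gal(K/k) → Kˣ) →* Kˣ where
  toFun f := ∏ x : Gal(K/k) ⧸ N, twist χ x.out (f x.out)
  map_one' := by simp
  map_mul' f f' := by simp [Finset.prod_mul_distrib]

/-- Equivariance of the norm: translation permutes the cosets, and the factors do not depend on the
representatives. -/
theorem coindNorm_translate {f : Gal(K/k) → Kˣ} (hf : f ∈ coind χ N) (g : Gal(K/k)) :
    coindNorm χ N (fun z => f (g⁻¹ * z)) = twist χ g (coindNorm χ N f) := by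
  change ∏ x : Gal(K/k) ⧸ N, twist χ x.out (f (g⁻¹ * x.out)) =
    twist χ g (∏ x : Gal(K/k) ⧸ N, twist χ x.out (f x.out))
  rw [map_prod]
  refine Fintype.prod_equiv (MulAction.toPerm g⁻¹) _ _ fun x => ?_
  have h1 : (((g⁻¹ • x).out : Gal(K/k)) : Gal(K/k) ⧸ N) = ((g⁻¹ * x.out : Gal(K/k)) : _ ⧸ N) := by
    rw [QuotientGroup.out_eq', ← smul_eq_mul, ← MulAction.Quotient.smul_coe, QuotientGroup.out_eq']
  rw [MulAction.toPerm_apply, twist_coind hf h1, ← twist_mul, mul_inv_cancel_left]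

/-- The exponent `χ z` of the elementary cocycle cancels the twist, so the cohomological norm
becomes the Galois norm. -/
theorem coindNorm_elemCocycle (a : Kˣ) {g : Gal(K/k)} (hg : χ g ≠ 1) :
    coindNorm χ N (elemCocycle χ a g) = ∏ x : Gal(K/k) ⧸ N, x.out • a := by
  refine Finset.prod_congr rfl fun x _ => ?_
  rw [elemCocycle, if_neg hg, twist_apply, smul_zpow', ← zpow_mul, ← Units.val_mul, Int.units_mul_self,
    Units.val_one, zpow_one]

end TwistedCohomology

end ToricGalois


namespace ToricGalois

/-! ### The long exact sequence of a torus resolution, on cocycles. -/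

section TorusCohomology

variable {k K : Type*} [Field k] [Field K] [Algebra k K] {n : ℕ}

/-- The point of the torus with coordinates powers of a given element. -/
def powPoint (φ : Gal(K/k) →* GL (Fin n) ℤ) (y : Kˣ) (e : Fin n → ℤ) : TorusPoints φ :=
  fun j => y ^ e j

/-- A resolution `1 → T(K) → Coind → Kˣ → 1` of the points of a torus by a coinduced module and
the twisted module `Kˣ`, with a set-theoretic section whose coboundary is known on generators. -/
structure TorusResolution (φ : Gal(K/k) →* GL (Fin n) ℤ) (χ : Gal(K/k) →* ℤˣ)
    (N : Subgroup Gal(K/k)) [Fintype (Gal(K/k) ⧸ N)] {J : Type*} (g : J → Gal(K/k))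
    (b : J → Fin n → ℤ) where
  /-- The inclusion of the points of the torus. -/
  incl : TorusPoints φ →* (Gal(K/k) → Kˣ)
  incl_mem : ∀ t, incl t ∈ coind χ N
  incl_smul : ∀ h t x, incl (h • t) x = incl t (h⁻¹ * x)
  incl_injective : Function.Injective incl
  exact : ∀ f ∈ coind χ N, coindNorm χ N f = 1 → ∃ t, incl t = f
  norm_incl : ∀ t, coindNorm χ N (incl t) = 1
  /-- The section. -/
  lift : Kˣ → Gal(K/k) → Kˣ
  lift_mem : ∀ y, lift y ∈ coind χ N
  /-- The sign by which the section differs from a section of the norm. -/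
  sign : ℤˣ
  norm_lift : ∀ y, coindNorm χ N (lift y) = y ^ (sign : ℤ)
  lift_gen : ∀ y i, g i • y = y ^ ((χ (g i) : ℤˣ) : ℤ) → ∀ x, lift y ((g i)⁻¹ * x) =
    lift y x * incl (powPoint φ y fun j => b i j * ((χ (g i) : ℤˣ) : ℤ)) x

namespace TorusResolution

variable {φ : Gal(K/k) →* GL (Fin n) ℤ} {χ : Gal(K/k) →* ℤˣ} {N : Subgroup Gal(K/k)}
  [Fintype (Gal(K/k) ⧸ N)] {J : Type*} {g : J → Gal(K/k)} {b : J → Fin n → ℤ}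
  (R : TorusResolution φ χ N g b)

theorem exists_norm_eq (R : TorusResolution φ χ N g b) (y : Kˣ) : ∃ f ∈ coind χ N, coindNorm χ N f = y := by
  refine ⟨R.lift (y ^ (R.sign : ℤ)), R.lift_mem _, ?_⟩
  rw [R.norm_lift, ← zpow_mul, ← Units.val_mul, Int.units_mul_self, Units.val_one, zpow_one]

/-- The cocycle `c` becomes cohomologous to the elementary cocycle of `a` in the coinduced
module. -/
def IsCohomologous (c : Gal(K/k) → TorusPoints φ) (a : Kˣ) : Prop :=
  ∃ f ∈ coind χ N, ∀ g z, R.incl (c g) z = elemCocycle χ a g z * (f (g⁻¹ * z) / f z)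

theorem isCohomologous_mul {c c' : Gal(K/k) → TorusPoints φ} {a a' : Kˣ}
    (h : R.IsCohomologous c a) (h' : R.IsCohomologous c' a') :
    R.IsCohomologous (c * c') (a * a') := by
  obtain ⟨f, hf, h⟩ := h
  obtain ⟨f', hf', h'⟩ := h'
  refine ⟨f * f', mul_mem hf hf', fun g z => ?_⟩
  rw [Pi.mul_apply, map_mul, Pi.mul_apply, h, h', elemCocycle_mul_left, Pi.mul_apply, Pi.mul_apply,
    mul_div_mul_comm]
  exact mul_mul_mul_comm _ _ _ _

theorem isCohomologous_inv {c : Gal(K/k) → TorusPoints φ} {a : Kˣ}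
    (h : R.IsCohomologous c a) : R.IsCohomologous c⁻¹ a⁻¹ := by
  obtain ⟨f, hf, h⟩ := h
  refine ⟨f⁻¹, inv_mem hf, fun g z => ?_⟩
  have h1 : elemCocycle χ a⁻¹ g z = (elemCocycle χ a g z)⁻¹ := by
    unfold elemCocycle
    split_ifs <;> simp
  rw [Pi.inv_apply, map_inv, Pi.inv_apply, h, h1, Pi.inv_apply, Pi.inv_apply, mul_inv, inv_div_inv,
    inv_div]

theorem incl_cocycle (c : Z1 Gal(K/k) (TorusPoints φ)) (g h z : Gal(K/k)) :
    R.incl ((c : Gal(K/k) → TorusPoints φ) (g * h)) z =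
      R.incl ((c : Gal(K/k) → TorusPoints φ) h) (g⁻¹ * z) *
        R.incl ((c : Gal(K/k) → TorusPoints φ) g) z := by
  rw [c.2 g h, map_mul, Pi.mul_apply, R.incl_smul]

/-- Shapiro's lemma for the quotient of the two cocycles: it suffices to compare values at `1` on
`N`. -/
theorem isCohomologous_of_eval (c : Z1 Gal(K/k) (TorusPoints φ)) {a : Kˣ}
    (ha : ∀ h ∈ N, h • a = a) (x : Kˣ) (h : ∀ h ∈ N,
      R.incl ((c : Gal(K/k) → TorusPoints φ) h) 1 = elemCocycle χ a h 1 * (twist χ h x / x)) :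
    R.IsCohomologous c a := by
  obtain ⟨f, hf, h⟩ := exists_coboundary_coind
    (fun g z => R.incl ((c : Gal(K/k) → TorusPoints φ) g) z / elemCocycle χ a g z)
    (fun g => div_mem (R.incl_mem _) (elemCocycle_mem ha g))
    (fun g h z => by rw [R.incl_cocycle, elemCocycle_mul, mul_div_mul_comm]) x
    (fun h' hh' => by rw [h h' hh', mul_div_cancel_left])
  exact ⟨f, hf, fun g z => by rw [← h, mul_div_cancel]⟩

theorem exists_isCohomologous [FiniteDimensional k K]
    (c : Z1 Gal(K/k) (TorusPoints φ)) :
    ∃ a : Kˣ, (∀ h ∈ N, h • a = a) ∧ R.IsCohomologous c a := by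
  obtain ⟨a, x, ha, hx⟩ := exists_elemCocycle (χ := χ) (N := N)
    (fun h => R.incl ((c : Gal(K/k) → TorusPoints φ) h) 1) fun g hg h _ => by
      rw [R.incl_cocycle, mul_one]
      have := R.incl_mem ((c : Gal(K/k) → TorusPoints φ) h) 1 g⁻¹ (inv_mem hg)
      rw [one_mul, inv_inv] at this
      rw [this]
  exact ⟨a, ha, R.isCohomologous_of_eval c ha x hx⟩

theorem isCohomologous_one {a : Kˣ} (ha : ∀ h ∈ N, h • a = a)
    (h : ∃ x : Kˣ, ∀ h ∈ N, if χ h = 1 then h • x = x else a = x * h • x) :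
    R.IsCohomologous 1 a := by
  obtain ⟨x, hx⟩ := h
  refine R.isCohomologous_of_eval 1 ha x fun h hh => ?_
  have h1 := hx h hh
  change R.incl 1 1 = _
  rw [map_one, Pi.one_apply, elemCocycle]
  split_ifs at h1 ⊢ with hχ
  · rw [twist_of_eq_one χ hχ, h1, div_self', one_mul]
  · rw [twist_of_ne_one χ hχ, map_one, Units.val_one, zpow_one, h1, mul_div_assoc', mul_assoc,
      mul_inv_cancel, mul_one, div_self']

/-- Evaluation at `1` on `N` turns a trivialization of the elementary cocycle into an expression of
`a` as a norm, with witness `f 1`. -/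
theorem exists_of_isCohomologous_one {a : Kˣ} (h : R.IsCohomologous 1 a) :
    ∃ x : Kˣ, ∀ h ∈ N, if χ h = 1 then h • x = x else a = x * h • x := by
  obtain ⟨f, hf, h⟩ := h
  refine ⟨f 1, fun g hg => ?_⟩
  have h1 := h g 1
  have h2 := hf 1 g⁻¹ (inv_mem hg)
  rw [one_mul, inv_inv] at h2
  rw [Pi.one_apply, map_one, Pi.one_apply, mul_one, h2, elemCocycle] at h1
  split_ifs at h1 ⊢ with hχ
  · rw [one_mul, twist_of_eq_one χ hχ] at h1
    exact (div_eq_one.1 h1.symm)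
  · rw [map_one, Units.val_one, zpow_one, twist_of_ne_one χ hχ] at h1
    rw [eq_inv_of_mul_eq_one_left h1.symm, inv_div, div_inv_eq_mul]

/-- The norm kills the points of the torus, so applying it shows that the elementary cocycle of the
norm of `a` is a coboundary in the twisted `Kˣ`. -/
theorem norm_of_isCohomologous {c : Gal(K/k) → TorusPoints φ} {a : Kˣ}
    (h : R.IsCohomologous c a) : ∃ x : Kˣ, ∀ g : Gal(K/k),
      if χ g = 1 then g • x = x else (∏ y : Gal(K/k) ⧸ N, y.out • a) = x * g • x := by
  obtain ⟨f, hf, h⟩ := h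
  refine ⟨coindNorm χ N f, fun g => ?_⟩
  have h1 : R.incl (c g) = elemCocycle χ a g * ((fun z => f (g⁻¹ * z)) / f) := funext (h g)
  have h2 := R.norm_incl (c g)
  rw [h1, map_mul, map_div, coindNorm_translate hf] at h2
  split_ifs with hχ
  · have h3 : elemCocycle χ a g = 1 := by
      funext z
      rw [elemCocycle, if_pos hχ]
      rfl
    rw [h3, map_one, one_mul, twist_of_eq_one χ hχ] at h2
    exact div_eq_one.1 h2
  · rw [coindNorm_elemCocycle a hχ, twist_of_ne_one χ hχ, mul_div_assoc', div_eq_one,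
      mul_inv_eq_iff_eq_mul] at h2
    exact h2

theorem exists_isCohomologous_of_norm {a : Kˣ} (ha : ∀ h ∈ N, h • a = a)
    (h : ∃ x : Kˣ, ∀ g : Gal(K/k),
      if χ g = 1 then g • x = x else (∏ y : Gal(K/k) ⧸ N, y.out • a) = x * g • x) :
    ∃ c : Z1 Gal(K/k) (TorusPoints φ), R.IsCohomologous c a := by
  obtain ⟨x, hx⟩ := h
  obtain ⟨f, hf, hfx⟩ := R.exists_norm_eq x
  -- With `f` of norm `x`, the coboundary of `f` corrects the elementary cocycle to one of norm one,
  -- hence with values in the torus.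
  let C : Gal(K/k) → Gal(K/k) → Kˣ := fun g => elemCocycle χ a g * ((fun z => f (g⁻¹ * z)) / f)
  have hC : ∀ g, ∃ t, R.incl t = C g := fun g => by
    refine R.exact _ (mul_mem (elemCocycle_mem ha g) (div_mem (coind_translate hf g) hf)) ?_
    have h1 := hx g
    rw [map_mul, map_div, coindNorm_translate hf, hfx]
    split_ifs at h1 with hχ
    · have h3 : elemCocycle χ a g = 1 := by
        funext z
        rw [elemCocycle, if_pos hχ]
        rfl
      rw [h3, map_one, one_mul, twist_of_eq_one χ hχ, h1, div_self']
    · rw [coindNorm_elemCocycle a hχ, twist_of_ne_one χ hχ, h1, mul_div_assoc', mul_assoc,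
        mul_inv_cancel, mul_one, div_self']
  choose t ht using hC
  refine ⟨⟨t, fun g h => R.incl_injective ?_⟩, f, hf, fun g z => congrFun (ht g) z⟩
  funext z
  rw [map_mul, Pi.mul_apply, R.incl_smul, ht, ht, ht]
  change elemCocycle χ a (g * h) z * (f ((g * h)⁻¹ * z) / f z) =
    elemCocycle χ a h (g⁻¹ * z) * (f (h⁻¹ * (g⁻¹ * z)) / f (g⁻¹ * z)) *
      (elemCocycle χ a g z * (f (g⁻¹ * z) / f z))
  rw [elemCocycle_mul, mul_mul_mul_comm, div_mul_div_cancel, mul_inv_rev, mul_assoc h⁻¹]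

theorem isCohomologous_coboundary {c : Z1 Gal(K/k) (TorusPoints φ)}
    (hc : c ∈ B1 Gal(K/k) (TorusPoints φ)) : R.IsCohomologous c 1 := by
  obtain ⟨t, ht⟩ := hc
  refine ⟨R.incl t, R.incl_mem t, fun g z => ?_⟩
  rw [← ht g, map_div, Pi.div_apply, R.incl_smul, elemCocycle]
  simp

/-- Cocycles which agree on generators are equal. -/
theorem eq_of_eq_on_generators (hgen : Subgroup.closure (Set.range g) = ⊤)
    {C C' : Gal(K/k) → Gal(K/k) → Kˣ}
    (hC : ∀ g h z, C (g * h) z = C h (g⁻¹ * z) * C g z)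
    (hC' : ∀ g h z, C' (g * h) z = C' h (g⁻¹ * z) * C' g z)
    (h : ∀ i z, C (g i) z = C' (g i) z) (x z : Gal(K/k)) : C x z = C' x z := by
  have h1 : ∀ {D : Gal(K/k) → Gal(K/k) → Kˣ}, (∀ g h z, D (g * h) z = D h (g⁻¹ * z) * D g z) →
      ∀ z, D 1 z = 1 := fun hD z => by
    have := hD 1 1 z
    rwa [one_mul, inv_one, one_mul, right_eq_mul] at this
  have hx : x ∈ Subgroup.closure (Set.range g) := hgen ▸ Subgroup.mem_top x
  induction hx using Subgroup.closure_induction generalizing z with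
  | mem x hx =>
    obtain ⟨i, rfl⟩ := hx
    exact h i z
  | one => rw [h1 hC, h1 hC']
  | mul x y _ _ hx hy => rw [hC, hC', hx, hy]
  | inv x _ hx =>
    have e := hC x⁻¹ x z
    have e' := hC' x⁻¹ x z
    rw [inv_mul_cancel, h1 hC, hx] at e
    rw [inv_mul_cancel, h1 hC'] at e'
    exact mul_left_cancel (e.symm.trans e')

theorem mk_mem_of_isCohomologous_one {U : Representation ℤ Gal(K/k) ℤ}
    (hU : ∀ x, U x 1 = ((χ x : ℤˣ) : ℤ)) {c : Z1 Gal(K/k) (TorusPoints φ)}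
    (h : R.IsCohomologous c 1) :
    (QuotientGroup.mk c : H1 Gal(K/k) (TorusPoints φ)) ∈ explicitSubgroup φ g U b := by
  obtain ⟨f, hf, h⟩ := h
  have hone : ∀ x z : Gal(K/k), elemCocycle χ (1 : Kˣ) x z = 1 := fun x z => by
    unfold elemCocycle
    simp
  simp only [hone, one_mul] at h
  -- The coboundary of `f` has norm one, so the norm of `f` is invariant. The exponent makes the
  -- norm of `lift y` equal to that of `f`, and `f / lift y` then comes from the torus.
  let y : Kˣ := coindNorm χ N f ^ (R.sign : ℤ)
  have hy : ∀ x, twist χ x y = y := fun x => by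
    have h1 : R.incl ((c : Gal(K/k) → TorusPoints φ) x) = (fun z => f (x⁻¹ * z)) / f := funext (h x)
    have h2 := R.norm_incl ((c : Gal(K/k) → TorusPoints φ) x)
    rw [h1, map_div, coindNorm_translate hf, div_eq_one] at h2
    simp only [y]
    rw [map_zpow, h2]
  have hy' : ∀ x : Gal(K/k), x • y = y ^ ((χ x : ℤˣ) : ℤ) := fun x => by
    conv_rhs => rw [← hy x, twist_apply]
    rw [← zpow_mul, ← Units.val_mul, Int.units_mul_self, Units.val_one, zpow_one]
  obtain ⟨t, ht⟩ := R.exact (f / R.lift y) (div_mem hf (R.lift_mem y)) (by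
    rw [map_div, R.norm_lift, ← zpow_mul, ← Units.val_mul, Int.units_mul_self, Units.val_one,
      zpow_one, div_self'])
  let d : Z1 Gal(K/k) (TorusPoints φ) :=
    ⟨fun x => x • t / t, fun x z => by
      change (x * z) • t / t = x • (z • t / t) * (x • t / t)
      rw [mul_smul, smul_div', div_mul_div_cancel]⟩
  have hd : d ∈ B1 Gal(K/k) (TorusPoints φ) := ⟨t, fun x => rfl⟩
  refine Subgroup.subset_closure ⟨y, c / d, fun i => ?_, fun i => ?_, ?_⟩
  · rw [hU, hy']
  · apply R.incl_injective
    funext z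
    have e1 := R.lift_gen y i (hy' _) z
    have e2 : ∀ z, R.incl t z = f z / R.lift y z := fun z => congrFun ht z
    change R.incl ((c : Gal(K/k) → TorusPoints φ) (g i) / (g i • t / t)) z = _
    rw [map_div, map_div, Pi.div_apply, Pi.div_apply, R.incl_smul, h, e2, e2]
    simp only [hU]
    change _ = R.incl (powPoint φ y fun j => b i j * ((χ (g i) : ℤˣ) : ℤ)) z
    rw [← mul_div_cancel_left (R.lift y z) (R.incl (powPoint φ y _) z), ← e1,
      div_div_div_comm (f _), div_div_cancel, div_div_cancel]
  · rw [QuotientGroup.eq_iff_div_mem, div_div_cancel]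
    exact hd

theorem isCohomologous_one_of_mk_mem (hgen : Subgroup.closure (Set.range g) = ⊤)
    {U : Representation ℤ Gal(K/k) ℤ}
    (hU : ∀ x, U x 1 = ((χ x : ℤˣ) : ℤ)) {c : Z1 Gal(K/k) (TorusPoints φ)}
    (hc : (QuotientGroup.mk c : H1 Gal(K/k) (TorusPoints φ)) ∈ explicitSubgroup φ g U b) :
    R.IsCohomologous c 1 := by
  let S : Subgroup (Z1 Gal(K/k) (TorusPoints φ)) :=
    { carrier := {c | R.IsCohomologous c 1}
      one_mem' := R.isCohomologous_coboundary (one_mem _)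
      mul_mem' := fun h h' => by simpa using R.isCohomologous_mul h h'
      inv_mem' := fun h => by simpa using R.isCohomologous_inv h }
  have hS : B1 Gal(K/k) (TorusPoints φ) ≤ S := fun _ h => R.isCohomologous_coboundary h
  have hle : explicitSubgroup φ g U b ≤ S.map (QuotientGroup.mk' _) := by
    refine (Subgroup.closure_le _).2 ?_
    rintro _ ⟨a, c, ha, hc, rfl⟩
    -- An explicit cocycle agrees on the generators with the coboundary of the lift of `a`, and a
    -- cocycle is determined by its values there.
    refine ⟨c, ⟨R.lift a, R.lift_mem a, fun x z => ?_⟩, rfl⟩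
    have hone : elemCocycle χ (1 : Kˣ) x z = 1 := by
      unfold elemCocycle
      simp
    rw [hone, one_mul]
    refine eq_of_eq_on_generators hgen
      (C := fun x z => R.incl ((c : Gal(K/k) → TorusPoints φ) x) z)
      (C' := fun x z => R.lift a (x⁻¹ * z) / R.lift a z) (R.incl_cocycle c)
      (fun x y z => ?_) (fun i z => ?_) x z
    · rw [div_mul_div_cancel, mul_inv_rev, mul_assoc]
    · have := R.lift_gen a i (by rw [ha, hU]) z
      simp only [hU] at hc
      rw [this, hc, mul_div_cancel_left]
      rfl
  obtain ⟨c', hc', h⟩ := hle hc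
  rw [QuotientGroup.mk'_apply, QuotientGroup.eq] at h
  have := S.mul_mem hc' (hS h)
  rwa [mul_inv_cancel_left] at this

/-- The cohomology of the torus modulo the subgroup of explicit classes is the kernel of the
homomorphism induced by the norm. -/
theorem nonempty_quotient_mulEquiv_ker (R : TorusResolution φ χ N g b) [FiniteDimensional k K]
    (hgen : Subgroup.closure (Set.range g) = ⊤) {U : Representation ℤ Gal(K/k) ℤ}
    (hU : ∀ x, U x 1 = ((χ x : ℤˣ) : ℤ)) {A B B' : Type*} [CommGroup A] [CommGroup B]
    [CommGroup B'] (j : A →* Kˣ) (hj : ∀ a, (∀ h ∈ N, h • a = a) ↔ a ∈ j.range)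
    (β : A →* B) (hβs : Function.Surjective β)
    (hβ : ∀ a, β a = 1 ↔ ∃ x : Kˣ, ∀ h ∈ N, if χ h = 1 then h • x = x else j a = x * h • x)
    (η : B →* B') (hη : ∀ a, η (β a) = 1 ↔ ∃ x : Kˣ, ∀ h : Gal(K/k),
      if χ h = 1 then h • x = x else (∏ y : Gal(K/k) ⧸ N, y.out • j a) = x * h • x) :
    Nonempty (H1 Gal(K/k) (TorusPoints φ) ⧸ explicitSubgroup φ g U b ≃* η.ker) := by
  have hfix : ∀ a, ∀ h ∈ N, h • j a = j a := fun a => (hj _).2 ⟨a, rfl⟩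
  have hex : ∀ c : Z1 Gal(K/k) (TorusPoints φ), ∃ a, R.IsCohomologous c (j a) := fun c => by
    obtain ⟨a, ha, h⟩ := R.exists_isCohomologous c
    obtain ⟨a, rfl⟩ := (hj a).1 ha
    exact ⟨a, h⟩
  have huniq : ∀ (c : Gal(K/k) → TorusPoints φ) (a a' : A), R.IsCohomologous c (j a) →
      R.IsCohomologous c (j a') → β a = β a' := fun c a a' h h' => by
    have h1 := R.isCohomologous_mul h (R.isCohomologous_inv h')
    rw [mul_inv_cancel, ← map_inv, ← map_mul] at h1
    have h2 := (hβ _).2 (R.exists_of_isCohomologous_one h1)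
    rwa [map_mul, map_inv, mul_inv_eq_one] at h2
  choose a ha using hex
  -- The parameter `a c` is only determined up to norms, so its class under `β` is well defined and
  -- multiplicative.
  let Ψ₀ : Z1 Gal(K/k) (TorusPoints φ) →* B := MonoidHom.mk' (fun c => β (a c)) fun c c' => by
    rw [← map_mul]
    refine huniq _ _ _ (ha (c * c')) ?_
    rw [map_mul]
    exact R.isCohomologous_mul (ha c) (ha c')
  have hΨ₀ : ∀ (c : Z1 Gal(K/k) (TorusPoints φ)) x, R.IsCohomologous c (j x) → Ψ₀ c = β x := fun c x h => huniq _ _ _ (ha c) h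
  have hB1 : ∀ c ∈ B1 Gal(K/k) (TorusPoints φ), Ψ₀ c = 1 := fun c hc => by
    rw [hΨ₀ c 1 (by rw [map_one]; exact R.isCohomologous_coboundary hc), map_one]
  let Ψ : H1 Gal(K/k) (TorusPoints φ) →* B := QuotientGroup.lift _ Ψ₀ hB1
  have hker : Ψ.ker = explicitSubgroup φ g U b := by
    ext x
    obtain ⟨c, rfl⟩ := QuotientGroup.mk_surjective x
    rw [MonoidHom.mem_ker]
    change Ψ₀ c = 1 ↔ _
    constructor
    · intro h
      have h1 := R.isCohomologous_one (hfix (a c)) ((hβ _).1 h)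
      have h2 := R.isCohomologous_mul (ha c) (R.isCohomologous_inv h1)
      rw [mul_inv_cancel, inv_one, mul_one] at h2
      exact R.mk_mem_of_isCohomologous_one hU h2
    · intro h
      have h1 := R.isCohomologous_one_of_mk_mem hgen hU h
      rw [hΨ₀ c 1 (by rwa [map_one]), map_one]
  have hrange : Ψ.range = η.ker := by
    ext x
    constructor
    · rintro ⟨y, rfl⟩
      obtain ⟨c, rfl⟩ := QuotientGroup.mk_surjective y
      exact (hη _).2 (R.norm_of_isCohomologous (ha c))
    · intro hx
      obtain ⟨y, rfl⟩ := hβs x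
      obtain ⟨c, hc⟩ := R.exists_isCohomologous_of_norm (hfix y) ((hη _).1 hx)
      exact ⟨QuotientGroup.mk c, hΨ₀ c y hc⟩
  exact ⟨(QuotientGroup.quotientMulEquivOfEq hker.symm).trans
    ((QuotientGroup.quotientKerEquivRange Ψ).trans (MulEquiv.subgroupCongr hrange))⟩

end TorusResolution

end TorusCohomology

end ToricGalois


namespace ToricGalois

/-! ### The sign character of a `G`-integer. -/

section SignCharacter

variable {G : Type*} [Group G]

theorem apply_eq_mul (U : Representation ℤ G ℤ) (g : G) (z : ℤ) : U g z = z * U g 1 := by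
  conv_lhs => rw [← mul_one z, ← smul_eq_mul, map_smul, smul_eq_mul]

/-- The sign character of a `G`-integer. -/
def signCharacter (U : Representation ℤ G ℤ) : G →* ℤˣ :=
  MonoidHom.toHomUnits
    { toFun := fun g => U g 1
      map_one' := by simp
      map_mul' := fun g h => by
        rw [map_mul, Module.End.mul_apply, apply_eq_mul, mul_comm] }

theorem signCharacter_apply (U : Representation ℤ G ℤ) (g : G) :
    ((signCharacter U g : ℤˣ) : ℤ) = U g 1 := rfl

end SignCharacter

/-! ### The induced lattice and its coordinates along cosets. -/

section InducedLattice

variable {G : Type*} [Group G] (U : Representation ℤ G ℤ) (N : Subgroup G)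

open Representation

/-- The underlying module of the induced module of a `G`-integer. -/
abbrev IndLattice : Type _ := IndV N.subtype (U.comp N.subtype)

/-- The translates of the generator of the induced module. -/
noncomputable def indGen (x : G) : IndLattice U N :=
  -- The inverse is needed because in this model `g` acts on the first factor by right
  -- multiplication by `g⁻¹`; this element plays the role of `x ⊗ 1`.
  IndV.mk N.subtype (U.comp N.subtype) x⁻¹ 1

theorem indGInteger_indGen (g x : G) : indGInteger U N g (indGen U N x) = indGen U N (g * x) := by
  rw [indGen, indGen, mul_inv_rev]
  exact ind_mk _ _ _ _ _

theorem indGen_mul (x h : G) (hh : h ∈ N) :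
    indGen U N (x * h) = ((signCharacter U h : ℤˣ) : ℤ) • indGen U N x := by
  have h1 := Coinvariants.mk_self_apply
    (Representation.tprod ((leftRegular ℤ G).comp N.subtype) (U.comp N.subtype))
    ⟨h⁻¹, inv_mem hh⟩ ((MonoidAlgebra.single x⁻¹ 1 : MonoidAlgebra ℤ G) ⊗ₜ[ℤ] (U h 1))
  have h2 : U h⁻¹ (U h 1) = 1 := by
    rw [← Module.End.mul_apply, ← map_mul, inv_mul_cancel, MonoidHom.map_one, Module.End.one_apply]
  rw [Representation.tprod_apply, TensorProduct.map_tmul] at h1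
  simp only [MonoidHom.comp_apply, Subgroup.subtype_apply, leftRegular, ofMulAction_single,
    smul_eq_mul, h2] at h1
  rw [signCharacter_apply, indGen, indGen, mul_inv_rev, ← map_smul, smul_eq_mul, mul_one]
  exact h1

theorem indLattice_hom_ext {A : Type*} [AddCommGroup A] {f f' : IndLattice U N →ₗ[ℤ] A}
    (h : ∀ x, f (indGen U N x) = f' (indGen U N x)) : f = f' := by
  refine IndV.hom_ext _ _ fun x => LinearMap.ext_ring ?_
  have := h x⁻¹
  rwa [indGen, inv_inv] at this

/-- The coefficient at the trivial coset. Its translates are the coordinates at all cosets, and it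
is what converts the induced lattice into functions on `G`. -/
theorem exists_indLattice_functional [DecidablePred (· ∈ N)] :
    ∃ α : IndLattice U N →ₗ[ℤ] ℤ, ∀ x, α (indGen U N x) =
      if x ∈ N then ((signCharacter U x : ℤˣ) : ℤ) else 0 := by
  let F : G → ℤ →ₗ[ℤ] ℤ := fun x => if x ∈ N then U x⁻¹ else 0
  refine ⟨Coinvariants.lift _ (TensorProduct.lift ((Finsupp.lift _ _ _ F) ∘ₗ
      (MonoidAlgebra.coeffLinearEquiv ℤ).toLinearMap)) fun g => ?_, fun x => ?_⟩
  · ext x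
    have h1 : (g : G) * x ∈ N ↔ x ∈ N := Subgroup.mul_mem_cancel_left N g.2
    have h2 : U ((g : G))⁻¹ (U g 1) = 1 := by
      rw [← Module.End.mul_apply, ← map_mul, inv_mul_cancel, MonoidHom.map_one, Module.End.one_apply]
    simp only [F, LinearMap.coe_comp, Function.comp_apply, MonoidAlgebra.lsingle_apply]
    by_cases hx : x ∈ N
    · simp [h1, hx, h2]
    · simp [h1, hx]
  · rw [indGen]
    refine (Coinvariants.lift_mk _ _ _ _).trans ?_
    simp only [TensorProduct.mk_apply, TensorProduct.lift.tmul, F]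
    by_cases hx : x ∈ N
    · simp [hx, signCharacter_apply]
    · simp [hx]

variable {U N}

theorem functional_comp [DecidablePred (· ∈ N)] {α : IndLattice U N →ₗ[ℤ] ℤ}
    (hα : ∀ x, α (indGen U N x) = if x ∈ N then ((signCharacter U x : ℤˣ) : ℤ) else 0)
    (h : G) (hh : h ∈ N) (v : IndLattice U N) :
    α (indGInteger U N h v) = ((signCharacter U h : ℤˣ) : ℤ) * α v := by
  have : α ∘ₗ indGInteger U N h = ((signCharacter U h : ℤˣ) : ℤ) • α := by
    refine indLattice_hom_ext U N fun x => ?_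
    rw [LinearMap.comp_apply, indGInteger_indGen, hα, LinearMap.smul_apply, hα, map_mul,
      Units.val_mul, smul_eq_mul, mul_ite, mul_zero]
    simp only [Subgroup.mul_mem_cancel_left N hh]
  exact LinearMap.congr_fun this v

theorem sum_functional_smul [DecidablePred (· ∈ N)] [Fintype (G ⧸ N)]
    {α : IndLattice U N →ₗ[ℤ] ℤ}
    (hα : ∀ x, α (indGen U N x) = if x ∈ N then ((signCharacter U x : ℤˣ) : ℤ) else 0)
    (v : IndLattice U N) :
    ∑ x : G ⧸ N, α (indGInteger U N x.out⁻¹ v) • indGen U N x.out = v := by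
  have : ∑ x : G ⧸ N, (α ∘ₗ indGInteger U N x.out⁻¹).smulRight (indGen U N x.out) =
      LinearMap.id := by
    refine indLattice_hom_ext U N fun y => ?_
    rw [LinearMap.sum_apply, Finset.sum_eq_single (y : G ⧸ N)]
    · have h1 : (y : G ⧸ N).out⁻¹ * y ∈ N := QuotientGroup.eq.1 (QuotientGroup.out_eq' _)
      have h2 := indGen_mul U N (y : G ⧸ N).out _ h1
      rw [mul_inv_cancel_left] at h2
      rw [LinearMap.smulRight_apply, LinearMap.comp_apply, indGInteger_indGen, hα, if_pos h1, ← h2]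
      rfl
    · intro x _ hx
      have h1 : x.out⁻¹ * y ∉ N := fun h => hx (by
        rw [← QuotientGroup.eq.2 h, QuotientGroup.out_eq'])
      rw [LinearMap.smulRight_apply, LinearMap.comp_apply, indGInteger_indGen, hα, if_neg h1,
        zero_smul]
    · simp
  have h := LinearMap.congr_fun this v
  rw [LinearMap.sum_apply] at h
  exact h

end InducedLattice
end ToricGalois


namespace ToricGalois

/-! ### Base change matrices from the similarity condition. -/

section LatticeMatrices

variable {G : Type*} [Group G] {n : ℕ}

/-- The matrices of base change between a basis of the induced lattice adapted to the exact sequence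
`0 → ℤⁿ → Ind U → U → 0` and the standard basis indexed by the cosets. -/
structure AdaptedMatrices (χ : G →* ℤˣ) (N : Subgroup G) [Fintype (G ⧸ N)]
    (φ : G →* GL (Fin n) ℤ) {J : Type*} (g : J → G) (b : J → Fin n → ℤ) where
  /-- The coordinates of the adapted basis. -/
  coord : G → Unit ⊕ Fin n → ℤ
  /-- The coordinates of the standard basis with respect to the adapted one. -/
  inv : Unit ⊕ Fin n → G → ℤ
  /-- The image of the standard generator in `U`. -/
  sign : ℤˣ
  coord_mul : ∀ x, ∀ h ∈ N, ∀ l, coord (x * h) l = ((χ h : ℤˣ) : ℤ) * coord x l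
  sum_inv_coord : ∀ l l', ∑ x : G ⧸ N, inv l x.out * coord x.out l' = if l = l' then 1 else 0
  sum_coord_inv_of_mem : ∀ x z, z⁻¹ * x ∈ N → ∑ l, inv l x * coord z l = ((χ (z⁻¹ * x) : ℤˣ) : ℤ)
  sum_coord_inv_of_notMem : ∀ x z, z⁻¹ * x ∉ N → ∑ l, inv l x * coord z l = 0
  inv_inl : ∀ u x, inv (Sum.inl u) x = ((χ x : ℤˣ) : ℤ) * ((sign : ℤˣ) : ℤ)
  coord_inr : ∀ h x i, coord (h⁻¹ * x) (Sum.inr i) =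
    ∑ j, (φ h : Matrix (Fin n) (Fin n) ℤ) j i * coord x (Sum.inr j)
  coord_inl : ∀ i x u, coord ((g i)⁻¹ * x) (Sum.inl u) =
    ((χ (g i) : ℤˣ) : ℤ) * coord x (Sum.inl u) + ∑ j, b i j * coord x (Sum.inr j)

variable (U : Representation ℤ G ℤ) (N : Subgroup G) (φ : G →* GL (Fin n) ℤ)
  {J : Type*} (g : J → G) (b : J → Fin n → ℤ)

variable {U N φ g b} in
-- The block form is assumed on the generators only; it propagates to all of `G`, making the last
-- `n` vectors a copy of `ℤⁿ` with the action `φ`.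
theorem rep_basis_inr {v : Module.Basis (Unit ⊕ Fin n) ℤ (IndLattice U N)}
    (hgen : Subgroup.closure (Set.range g) = ⊤)
    (hv : ∀ i, LinearMap.toMatrix v v (indGInteger U N (g i)) =
      borderedMatrix (U (g i) 1) (b i) (φ (g i))) (x : G) (w : Fin n → ℤ) :
    indGInteger U N x (∑ j, w j • v (Sum.inr j)) =
      ∑ j, ((φ x : Matrix (Fin n) (Fin n) ℤ).mulVec w) j • v (Sum.inr j) := by
  have hx : x ∈ Subgroup.closure (Set.range g) := hgen ▸ Subgroup.mem_top x
  induction hx using Subgroup.closure_induction generalizing w with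
  | mem x hx =>
    obtain ⟨i, rfl⟩ := hx
    have h1 : ∀ j, indGInteger U N (g i) (v (Sum.inr j)) =
        ∑ l, (φ (g i) : Matrix (Fin n) (Fin n) ℤ) l j • v (Sum.inr l) := fun j => by
      rw [← v.sum_repr (indGInteger U N (g i) (v (Sum.inr j)))]
      simp only [← LinearMap.toMatrix_apply, hv, Fintype.sum_sum_type]
      simp [borderedMatrix]
    simp only [map_sum, map_smul, h1, Matrix.mulVec, dotProduct, Finset.smul_sum, Finset.sum_smul,
      smul_smul]
    rw [Finset.sum_comm]
    simp only [mul_comm]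
  | one => simp
  | mul x y _ _ hx hy =>
    rw [map_mul, Module.End.mul_apply, hy, hx, map_mul, Units.val_mul, Matrix.mulVec_mulVec]
  | inv x _ hx =>
    have h1 : w = (φ x : Matrix (Fin n) (Fin n) ℤ).mulVec
        ((φ x⁻¹ : Matrix (Fin n) (Fin n) ℤ).mulVec w) := by
      rw [Matrix.mulVec_mulVec, ← Units.val_mul, ← map_mul, mul_inv_cancel, map_one, Units.val_one,
        Matrix.one_mulVec]
    conv_lhs => rw [h1, ← hx, ← Module.End.mul_apply, ← map_mul, inv_mul_cancel, map_one]
    rfl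

variable {U N φ g b} in
-- The first coordinate is the equivariant projection onto `U`: the first row of each generator
-- matrix is `(ε, 0, …, 0)`.
theorem repr_inl_rep {v : Module.Basis (Unit ⊕ Fin n) ℤ (IndLattice U N)}
    (hgen : Subgroup.closure (Set.range g) = ⊤)
    (hv : ∀ i, LinearMap.toMatrix v v (indGInteger U N (g i)) =
      borderedMatrix (U (g i) 1) (b i) (φ (g i))) (x : G) (w : IndLattice U N) (u : Unit) :
    v.repr (indGInteger U N x w) (Sum.inl u) =
      ((signCharacter U x : ℤˣ) : ℤ) * v.repr w (Sum.inl u) := by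
  have hx : x ∈ Subgroup.closure (Set.range g) := hgen ▸ Subgroup.mem_top x
  induction hx using Subgroup.closure_induction generalizing w with
  | mem x hx =>
    obtain ⟨i, rfl⟩ := hx
    rw [signCharacter_apply, ← LinearMap.toMatrix_mulVec_repr v v, hv, Matrix.mulVec, dotProduct,
      Fintype.sum_sum_type]
    simp [borderedMatrix]
  | one => simp
  | mul x y _ _ hx hy =>
    rw [map_mul, Module.End.mul_apply, hx, hy, map_mul, Units.val_mul, mul_assoc]
  | inv x _ hx =>
    have h1 := hx (indGInteger U N x⁻¹ w)
    rw [← Module.End.mul_apply, ← map_mul, mul_inv_cancel, map_one, Module.End.one_apply] at h1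
    rw [h1, ← mul_assoc, ← Units.val_mul, ← map_mul, inv_mul_cancel, map_one, Units.val_one, one_mul]

/-- The similarity condition yields matrices of base change. -/
theorem nonempty_adaptedMatrices [Fintype (G ⧸ N)] (hgen : Subgroup.closure (Set.range g) = ⊤)
    (hsim : SimultaneouslySimilar (fun i => indGInteger U N (g i))
      (fun i => borderedMatrix (U (g i) 1) (b i) (φ (g i)))) :
    Nonempty (AdaptedMatrices (signCharacter U) N φ g b) := by
  classical
  obtain ⟨v, hv⟩ := hsim
  obtain ⟨α, hα⟩ := exists_indLattice_functional U N
  have hsum := sum_functional_smul hα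
  have hinv : ∀ u x, v.repr (indGen U N x) (Sum.inl u) =
      ((signCharacter U x : ℤˣ) : ℤ) * v.repr (indGen U N 1) (Sum.inl u) := fun u x => by
    rw [← repr_inl_rep hgen hv, indGInteger_indGen, mul_one]
  -- The projection to `U` takes the value one on the first basis vector, while on every standard
  -- generator it is a multiple of its value at `indGen U N 1`; hence that value divides one.
  have hunit : IsUnit (v.repr (indGen U N 1) (Sum.inl ())) := by
    have h1 := congrArg (fun w => v.repr w (Sum.inl ())) (hsum (v (Sum.inl ())))
    simp only [map_sum, map_smul, Finsupp.coe_finsetSum, Finset.sum_apply, Finsupp.smul_apply,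
      Module.Basis.repr_self, Finsupp.single_eq_same, smul_eq_mul] at h1
    refine isUnit_of_dvd_one (h1 ▸ Finset.dvd_sum fun x _ => ?_)
    rw [hinv () x.out, ← mul_assoc]
    exact dvd_mul_left _ _
  have hcoordinv : ∀ x z, ∑ l, v.repr (indGen U N x) l * α (indGInteger U N z⁻¹ (v l)) =
      if z⁻¹ * x ∈ N then ((signCharacter U (z⁻¹ * x) : ℤˣ) : ℤ) else 0 := fun x z => by
    rw [← hα, ← indGInteger_indGen]
    conv_rhs => rw [← v.sum_repr (indGen U N x)]
    simp only [map_sum, map_smul, smul_eq_mul]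
  refine ⟨{ coord := fun x l => α (indGInteger U N x⁻¹ (v l))
            inv := fun l x => v.repr (indGen U N x) l
            sign := hunit.unit
            coord_mul := fun x h hh l => ?_
            sum_inv_coord := fun l l' => ?_
            sum_coord_inv_of_mem := fun x z h => by rw [hcoordinv, if_pos h]
            sum_coord_inv_of_notMem := fun x z h => by rw [hcoordinv, if_neg h]
            inv_inl := fun u x => hinv u x
            coord_inr := fun h x i => ?_
            coord_inl := fun i x u => ?_ }⟩
  · rw [mul_inv_rev, map_mul, Module.End.mul_apply, functional_comp hα _ (inv_mem hh), map_inv,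
      Int.units_inv_eq_self]
  · have h1 := congrArg (fun w => v.repr w l) (hsum (v l'))
    simp only [map_sum, map_smul, Finsupp.coe_finsetSum, Finset.sum_apply, Finsupp.smul_apply,
      Module.Basis.repr_self, smul_eq_mul, Finsupp.single_apply] at h1
    simp only [mul_comm (v.repr _ l), h1, eq_comm (a := l)]
  · have h1 := rep_basis_inr hgen hv h (Pi.single i 1)
    rw [Finset.sum_eq_single i (fun j _ hj => by rw [Pi.single_eq_of_ne hj, zero_smul]) (by simp),
      Pi.single_eq_same, one_smul, Matrix.mulVec_single_one] at h1
    rw [mul_inv_rev, inv_inv, map_mul, Module.End.mul_apply, h1]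
    simp only [map_sum, map_smul, smul_eq_mul]
    rfl
  · have h1 : indGInteger U N (g i) (v (Sum.inl u)) =
        U (g i) 1 • v (Sum.inl u) + ∑ l, b i l • v (Sum.inr l) := by
      rw [← v.sum_repr (indGInteger U N (g i) (v (Sum.inl u)))]
      simp only [← LinearMap.toMatrix_apply, hv, Fintype.sum_sum_type]
      simp [borderedMatrix]
    rw [mul_inv_rev, inv_inv, map_mul, Module.End.mul_apply, h1]
    simp only [map_add, map_sum, map_smul, smul_eq_mul]
    rfl

end LatticeMatrices

end ToricGalois


namespace ToricGalois

/-! ### The torus resolution obtained by tensoring with the units. -/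

section ResolutionOfMatrices

variable {k K : Type*} [Field k] [Field K] [Algebra k K] {n : ℕ}
  {φ : Gal(K/k) →* GL (Fin n) ℤ} {χ : Gal(K/k) →* ℤˣ} {N : Subgroup Gal(K/k)}
  [Fintype (Gal(K/k) ⧸ N)] {J : Type*} {g : J → Gal(K/k)} {b : J → Fin n → ℤ}

theorem prod_zpow_eq_zpow_sum {A ι : Type*} [CommGroup A] (s : Finset ι) (x : A) (f : ι → ℤ) :
    ∏ i ∈ s, x ^ f i = x ^ ∑ i ∈ s, f i := by
  induction s using Finset.cons_induction with
  | empty => simp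
  | cons i s hi h => rw [Finset.prod_cons, Finset.sum_cons, h, zpow_add]

theorem torusPoints_smul_apply (h : Gal(K/k)) (t : TorusPoints φ) (j : Fin n) :
    (h • t) j = ∏ i, (h • t i) ^ ((φ h : Matrix (Fin n) (Fin n) ℤ) j i) := rfl

namespace AdaptedMatrices

variable (D : AdaptedMatrices χ N φ g b)

/-- The map to the coinduced module from the coordinates with respect to the adapted basis. -/
def toCoind : (Unit ⊕ Fin n → Kˣ) →* (Gal(K/k) → Kˣ) where
  toFun p x := ∏ l, (x⁻¹ • p l) ^ D.coord x l
  map_one' := by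
    funext x
    simp
  map_mul' p q := by
    funext x
    simp [smul_mul', mul_zpow, Finset.prod_mul_distrib]

theorem toCoind_apply (p : Unit ⊕ Fin n → Kˣ) (x : Gal(K/k)) :
    D.toCoind p x = ∏ l, (x⁻¹ • p l) ^ D.coord x l := rfl

theorem toCoind_mem (p : Unit ⊕ Fin n → Kˣ) : D.toCoind p ∈ coind χ N := fun x h hh => by
  rw [toCoind_apply, toCoind_apply, map_prod]
  refine Finset.prod_congr rfl fun l _ => ?_
  rw [D.coord_mul x h hh, mul_inv_rev, mul_smul, twist_apply, map_inv, Int.units_inv_eq_self,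
    smul_zpow', ← zpow_mul, mul_comm]

/-- The coordinates of a function with respect to the adapted basis. -/
noncomputable def ofCoind (f : Gal(K/k) → Kˣ) (l : Unit ⊕ Fin n) : Kˣ :=
  ∏ x : Gal(K/k) ⧸ N, (x.out • f x.out) ^ D.inv l x.out

/-- The Galois actions cancel and what remains is the product of the two base change matrices. -/
theorem ofCoind_toCoind (p : Unit ⊕ Fin n → Kˣ) : D.ofCoind (D.toCoind p) = p := by
  funext l
  simp only [ofCoind, toCoind_apply, Finset.smul_prod', smul_zpow', smul_inv_smul,
    ← Finset.prod_zpow, ← zpow_mul]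
  rw [Finset.prod_comm]
  simp only [prod_zpow_eq_zpow_sum, mul_comm (D.coord _ _), D.sum_inv_coord]
  rw [Finset.prod_eq_single l (fun l' _ h => by rw [if_neg h.symm, zpow_zero]) (by simp),
    if_pos rfl, zpow_one]

theorem toCoind_ofCoind {f : Gal(K/k) → Kˣ} (hf : f ∈ coind χ N) : D.toCoind (D.ofCoind f) = f := by
  funext z
  simp only [toCoind_apply, ofCoind, Finset.smul_prod', smul_zpow', ← Finset.prod_zpow, ← zpow_mul]
  rw [Finset.prod_comm]
  simp only [prod_zpow_eq_zpow_sum]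
  rw [Finset.prod_eq_single (z : Gal(K/k) ⧸ N)]
  · have h1 : (z : Gal(K/k) ⧸ N).out⁻¹ * z ∈ N := QuotientGroup.eq.1 (QuotientGroup.out_eq' _)
    have h2 : z⁻¹ * (z : Gal(K/k) ⧸ N).out ∈ N := by
      have := inv_mem h1
      rwa [mul_inv_rev, inv_inv] at this
    have h3 := hf (z : Gal(K/k) ⧸ N).out ((z : Gal(K/k) ⧸ N).out⁻¹ * z) h1
    rw [mul_inv_cancel_left, mul_inv_rev, inv_inv] at h3
    rw [D.sum_coord_inv_of_mem _ _ h2, h3, twist_apply, mul_smul]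
  · intro x _ hx
    rw [D.sum_coord_inv_of_notMem, zpow_zero]
    intro h
    refine hx ?_
    rw [QuotientGroup.eq.2 h, QuotientGroup.out_eq']
  · simp

/-- The projection to `U`, tensored with `Kˣ`, is the coinduced norm up to the sign by which the
generator maps to `U`. -/
theorem ofCoind_inl (f : Gal(K/k) → Kˣ) (u : Unit) :
    D.ofCoind f (Sum.inl u) = coindNorm χ N f ^ (D.sign : ℤ) := by
  change _ = (∏ x : Gal(K/k) ⧸ N, twist χ x.out (f x.out)) ^ _
  rw [← Finset.prod_zpow]
  refine Finset.prod_congr rfl fun x _ => ?_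
  rw [D.inv_inl, zpow_mul, twist_apply]

theorem coindNorm_eq (f : Gal(K/k) → Kˣ) :
    coindNorm χ N f = D.ofCoind f (Sum.inl ()) ^ (D.sign : ℤ) := by
  rw [ofCoind_inl, ← zpow_mul, ← Units.val_mul, Int.units_mul_self, Units.val_one, zpow_one]

/-- The points of the torus as coordinate vectors. -/
def torusCoord (φ : Gal(K/k) →* GL (Fin n) ℤ) : TorusPoints φ →* (Unit ⊕ Fin n → Kˣ) where
  toFun t := Sum.elim 1 t
  map_one' := by
    funext l
    rcases l with _ | _ <;> rfl
  map_mul' s t := by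
    funext l
    rcases l with _ | _
    · exact (mul_one 1).symm
    · rfl

theorem toCoind_torusCoord (t : TorusPoints φ) (x : Gal(K/k)) :
    D.toCoind (torusCoord φ t) x = ∏ j, (x⁻¹ • t j) ^ D.coord x (Sum.inr j) := by
  have h1 : ∀ u, torusCoord φ t (Sum.inl u) = 1 := fun _ => rfl
  have h2 : ∀ j, torusCoord φ t (Sum.inr j) = t j := fun _ => rfl
  rw [toCoind_apply, Fintype.prod_sum_type]
  simp only [h1, h2, smul_one, one_zpow, Finset.prod_const_one, one_mul]

/-- The resolution of the points of the torus given by matrices of base change. -/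
noncomputable def torusResolution : TorusResolution φ χ N g b where
  incl := D.toCoind.comp (torusCoord φ)
  incl_mem t := D.toCoind_mem _
  incl_smul h t x := by
    rw [MonoidHom.comp_apply, MonoidHom.comp_apply, toCoind_torusCoord, toCoind_torusCoord]
    simp only [torusPoints_smul_apply, Finset.smul_prod', smul_zpow', ← Finset.prod_zpow,
      ← zpow_mul, smul_smul, mul_inv_rev, inv_inv]
    rw [Finset.prod_comm]
    simp only [prod_zpow_eq_zpow_sum, D.coord_inr h x]
  incl_injective s t h := by
    have h1 := congrArg D.ofCoind h
    simp only [MonoidHom.comp_apply, ofCoind_toCoind] at h1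
    funext j
    exact congrFun h1 (Sum.inr j)
  exact f hf h := by
    refine ⟨fun j => D.ofCoind f (Sum.inr j), ?_⟩
    change D.toCoind (torusCoord φ _) = f
    conv_rhs => rw [← D.toCoind_ofCoind hf]
    congr 1
    funext l
    rcases l with u | j
    · rw [ofCoind_inl, h, one_zpow]
      rfl
    · rfl
  norm_incl t := by
    rw [D.coindNorm_eq, MonoidHom.comp_apply, ofCoind_toCoind]
    exact one_zpow _
  lift y := D.toCoind (Sum.elim (fun _ => y) 1)
  lift_mem y := D.toCoind_mem _
  sign := D.sign
  norm_lift y := by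
    rw [D.coindNorm_eq, ofCoind_toCoind]
    rfl
  -- The lift is `y ⊗ v₀`. Since `g i` multiplies `v₀` by a sign and raises `y` to the same sign,
  -- the `v₀` part is unchanged and only the contribution of the `b i j` survives.
  lift_gen y i hy x := by
    rw [MonoidHom.comp_apply, toCoind_torusCoord, toCoind_apply, toCoind_apply,
      Fintype.prod_sum_type, Fintype.prod_sum_type]
    simp only [Finset.univ_unique, PUnit.default_eq_unit, Sum.elim_inl,
      Sum.elim_inr, Pi.one_apply, smul_one, one_zpow, Finset.prod_const_one, mul_one, mul_inv_rev,
      inv_inv, mul_smul, hy, powPoint, smul_zpow', ← zpow_mul, D.coord_inl, prod_zpow_eq_zpow_sum,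
      ← zpow_add]
    congr 1
    rw [Finset.sum_singleton, Finset.sum_singleton, mul_add, ← mul_assoc, ← Units.val_mul, Int.units_mul_self, Units.val_one, one_mul,
      Finset.mul_sum]
    congr 1
    refine Finset.sum_congr rfl fun j _ => ?_
    ring

end AdaptedMatrices

end ResolutionOfMatrices

end ToricGalois


namespace ToricGalois

/-! ### The two relative Brauer groups of the theorem. -/

section FixedFieldParametrization

variable {k K : Type*} [Field k] [Field K] [Algebra k K]

theorem signCharacter_eq_one_iff {G : Type*} [Group G] (U : Representation ℤ G ℤ) (g : G) :
    signCharacter U g = 1 ↔ g ∈ canonicalSubgroup U :=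
  Units.ext_iff

/-- The inclusion of the units of the fixed field. -/
def fixedUnits (N : Subgroup Gal(K/k)) : (IntermediateField.fixedField N)ˣ →* Kˣ :=
  Units.map (algebraMap (IntermediateField.fixedField N) K : IntermediateField.fixedField N →* K)

theorem mem_range_fixedUnits (N : Subgroup Gal(K/k)) (a : Kˣ) :
    (∀ h ∈ N, h • a = a) ↔ a ∈ (fixedUnits N).range := by
  constructor
  · intro ha
    have hmem : (a : K) ∈ IntermediateField.fixedField N := fun h =>
      congrArg Units.val (ha h h.2)
    exact ⟨Units.mk0 ⟨a, hmem⟩ fun h => a.ne_zero (congrArg Subtype.val h), Units.ext rfl⟩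
  · rintro ⟨a, rfl⟩ h hh
    exact Units.ext (a.1.2 ⟨h, hh⟩)

variable [FiniteDimensional k K] [IsGalois k K]

theorem norm_fixedUnits (N : Subgroup Gal(K/k)) [Fintype (Gal(K/k) ⧸ N)]
    (a : (IntermediateField.fixedField N)ˣ) :
    Units.map (algebraMap k K : k →* K)
      (Units.map (Algebra.norm k : IntermediateField.fixedField N →* k) a) =
      ∏ x : Gal(K/k) ⧸ N, x.out • fixedUnits N a := by
  refine Units.ext ?_
  rw [Units.coe_prod]
  exact norm_fixedField N a

/-- The parametrization of `Br(K^N|K^{I ∩ N})` for the canonical subgroup `I` of a `G`-integer. -/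
theorem exists_parametrization_fixedField (U : Representation ℤ Gal(K/k) ℤ)
    (N : Subgroup Gal(K/k)) :
    ∃ β : (IntermediateField.fixedField N)ˣ →* relBrauerGroup (IntermediateField.fixedField N)
        (IntermediateField.extendScalars (IntermediateField.fixedField_antitone
          (inf_le_right : canonicalSubgroup U ⊓ N ≤ N))),
      Function.Surjective β ∧ (∀ a x, IsCyclicClass a x ↔ x = β a) ∧
      ∀ a, β a = 1 ↔ ∃ x : Kˣ, ∀ h ∈ N,
        if signCharacter U h = 1 then h • x = x else fixedUnits N a = x * h • x := by
  -- The image of `ρ` is `N`, so restricting the sign character to `N` presents `K^{I ∩ N}` as the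
  -- field cut out by a quadratic character over `K^N`.
  let ρ : Gal(K/IntermediateField.fixedField N) →* Gal(K/k) :=
    AlgEquiv.restrictScalarsHom k
  have hρ : ∀ h, ρ (toFixedAut N h) = h := fun h => rfl
  obtain ⟨β, hβs, hβc, hβ⟩ := exists_relBrauerGroup_parametrization_character
    ((signCharacter U).comp ρ) (IntermediateField.extendScalars
      (IntermediateField.fixedField_antitone (inf_le_right : canonicalSubgroup U ⊓ N ≤ N)))
    (fun y => by
      rw [IntermediateField.mem_extendScalars, IntermediateField.mem_fixedField_iff]
      constructor
      · intro hy τ hτ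
        obtain ⟨h, rfl⟩ := exists_mem_eq_restrictScalars N τ
        exact hy h ⟨(signCharacter_eq_one_iff U _).1 hτ, h.2⟩
      · intro hy h hh
        exact hy (toFixedAut N ⟨h, hh.2⟩) ((signCharacter_eq_one_iff U _).2 hh.1))
  refine ⟨β, hβs, hβc, fun a => (hβ a).trans (exists_congr fun x => ?_)⟩
  constructor
  · intro hx h hh
    exact hx (toFixedAut N ⟨h, hh⟩)
  · intro hx τ
    obtain ⟨h, rfl⟩ := exists_mem_eq_restrictScalars N τ
    exact hx h h.2

/-- The parametrization of `Br(k|K^I)` for the canonical subgroup `I` of a `G`-integer. -/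
theorem exists_parametrization_base (U : Representation ℤ Gal(K/k) ℤ) :
    ∃ β : kˣ →* relBrauerGroup k (IntermediateField.fixedField (canonicalSubgroup U)),
      Function.Surjective β ∧ (∀ a x, IsCyclicClass a x ↔ x = β a) ∧
      ∀ a, β a = 1 ↔ ∃ x : Kˣ, ∀ g : Gal(K/k), if signCharacter U g = 1 then g • x = x
        else Units.map (algebraMap k K : k →* K) a = x * g • x :=
  exists_relBrauerGroup_parametrization_character (signCharacter U) _ fun y => by
    simp only [IntermediateField.mem_fixedField_iff, signCharacter_eq_one_iff]

end FixedFieldParametrization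

end ToricGalois

/-! ### The theorem. -/

theorem corollary3p11 {k K : Type*} [Field k] [Field K] [Algebra k K] [FiniteDimensional k K]
    [IsGalois k K] {n : ℕ} (φ : Gal(K/k) →* GL (Fin n) ℤ) (hφ : Function.Injective φ)
    -- two generators of the Galois group, which is dihedral or abelian
    (r s : Gal(K/k)) (hgen : Subgroup.closure {r, s} = ⊤)
    (hG : (∃ (m : ℕ) (e : Gal(K/k) ≃* DihedralGroup m) (i j : ZMod m),
        e r = DihedralGroup.r i ∧ e s = DihedralGroup.sr j) ∨
      ∀ x y : Gal(K/k), x * y = y * x)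
    -- the `G`-integer, and the subgroup of index `n + 1` with `G/N = {N, rN, …, rⁿN}`
    (U : Representation ℤ Gal(K/k) ℤ) (N : Subgroup Gal(K/k)) (hN : N.index = n + 1)
    (hcosets : ∀ x : Gal(K/k) ⧸ N, ∃ i : ℕ, i ≤ n ∧ x = QuotientGroup.mk (r ^ i))
    -- the similarity condition
    (b : Fin 2 → Fin n → ℤ)
    (hsim : ToricGalois.SimultaneouslySimilar
      (fun i => ToricGalois.indGInteger U N (![r, s] i))
      (fun i => ToricGalois.borderedMatrix (U (![r, s] i) 1) (b i) (φ (![r, s] i)))) :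
    ∃ η : ToricGalois.relBrauerGroup (IntermediateField.fixedField N)
          (IntermediateField.extendScalars (IntermediateField.fixedField_antitone
            (inf_le_right : ToricGalois.canonicalSubgroup U ⊓ N ≤ N))) →*
        ToricGalois.relBrauerGroup k
          (IntermediateField.fixedField (ToricGalois.canonicalSubgroup U)),
      ToricGalois.IsInducedByNorm η ∧
      (∀ η', ToricGalois.IsInducedByNorm η' → η' = η) ∧
      Nonempty (ToricGalois.H1 Gal(K/k) (ToricGalois.TorusPoints φ) ⧸
        ToricGalois.explicitSubgroup φ ![r, s] U b ≃* η.ker) := by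
  classical
  have : Finite (Gal(K/k) ⧸ N) := Quotient.finite _
  have : Fintype (Gal(K/k) ⧸ N) := Fintype.ofFinite _
  have hgen' : Subgroup.closure (Set.range ![r, s]) = ⊤ := by
    rw [Matrix.range_cons, Matrix.range_cons, Matrix.range_empty, Set.union_empty]
    exact hgen
  obtain ⟨D⟩ := ToricGalois.nonempty_adaptedMatrices U N φ ![r, s] b hgen' hsim
  let R := D.torusResolution
  obtain ⟨β, hβs, hβc, hβ⟩ := ToricGalois.exists_parametrization_fixedField U N
  obtain ⟨γ, -, hγc, hγ⟩ := ToricGalois.exists_parametrization_base U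
  let ν : (IntermediateField.fixedField N)ˣ →* kˣ :=
    Units.map (Algebra.norm k : IntermediateField.fixedField N →* k)
  have hγν : ∀ a, γ (ν a) = 1 ↔ ∃ x : Kˣ, ∀ g : Gal(K/k),
      if ToricGalois.signCharacter U g = 1 then g • x = x
      else (∏ y : Gal(K/k) ⧸ N, y.out • ToricGalois.fixedUnits N a) = x * g • x := fun a => by
    rw [hγ, ToricGalois.norm_fixedUnits]
  -- The norm respects the two norm subgroups: a parameter with trivial class corresponds to the
  -- trivial torus cocycle, whose image under the coinduced norm is trivial. Hence the norm descends
  -- to `η`.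
  have hker : β.ker ≤ (γ.comp ν).ker := fun a ha =>
    (hγν a).2 (R.norm_of_isCohomologous (R.isCohomologous_one
      ((ToricGalois.mem_range_fixedUnits N _).2 ⟨a, rfl⟩) ((hβ a).1 ha)))
  let η := β.liftOfSurjective hβs ⟨γ.comp ν, hker⟩
  have hη : ∀ a, η (β a) = γ (ν a) := fun a =>
    β.liftOfRightInverse_comp_apply _ (Function.rightInverse_surjInv hβs) ⟨γ.comp ν, hker⟩ a
  -- Uniqueness holds because every class over `K^N` is that of a cyclic algebra.
  refine ⟨η, fun a x hx => ?_, fun η' hη' => MonoidHom.ext fun x => ?_, ?_⟩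
  · rw [hγc, (hβc a x).1 hx]
    exact hη a
  · obtain ⟨a, rfl⟩ := hβs x
    rw [hη, (hγc _ _).1 (hη' a _ ((hβc _ _).2 rfl))]
  · exact R.nonempty_quotient_mulEquiv_ker hgen' (fun x => rfl) (ToricGalois.fixedUnits N)
      (ToricGalois.mem_range_fixedUnits N) β hβs hβ η fun a => by rw [hη, hγν]
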